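/- Let $g,n\ge 0$ be integers. A marked uni-trivalent graph is a finite graph (possibly empty or disconnected, loops and multiple edges allowed) all of whose vertices are trivalent or univalent, with a cyclic order of the three half-edges at every trivalent vertex and a label in $\{1,\dots,g\}$ (repetitions allowed) at every univalent vertex, together with a finite number of vertex-free circles. Let $\mathcal{B}_g$ be the complex vector space of finite linear combinations of isomorphism classes of such graphs modulo the relations AS (reversing the cyclic order at one trivalent vertex changes the sign) and IHX, and let $\mathcal{B}_g/O_n$ be its quotient by $O_n$: a circle may be removed at the cost of a factor $-2n$. **Theorem.** There are well-defined linear operators $L_{ij},\ h^i_{\;j},\ \Lambda^{ij}$ $(1\le i,j\le g)$ on $\mathcal{B}_g/O_n$ such that for every marked uni-trivalent graph $D$: * $L_{ij}[D]$ is the class of the disjoint union of $D$ with a single edge whose two univalent ends are marked $i$ and $j$; * $h^i_{\;j}[D]$ is the sum, over all univalent vertices $u$ of $D$ marked $i$, of the class of $D$ with $u$ relabelled $j$; * $\Lambda^{ij}[D]=-\frac14\sum_{(a,b)}[D_{ab}]$, the sum over ordered pairs of distinct univalent vertices with $a$ marked $i$ and $b$ marked $j$, where $D_{ab}$ is obtained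 by removing $a$ and $b$ and joining the two edges that ended there (if $a,b$ are the two ends of one edge, this edge becomes a circle). For $i=j$ this is $-\frac12$ times the sum over unordered pairs of univalent vertices marked $i$. They satisfy $$[\Lambda^{ij},L_{kl}]=\tfrac n2(\delta^i_l\delta^j_k+\delta^i_k\delta^j_l)-\tfrac14(\delta^i_kh^j_{\;l}+\delta^i_lh^j_{\;k}+\delta^j_kh^i_{\;l}+\delta^j_lh^i_{\;k}),$$ $$[h^k_{\;l},L_{ij}]=\delta^k_iL_{lj}+\delta^k_jL_{il},\qquad [h^k_{\;l},\Lambda^{ij}]=-\delta^i_l\Lambda^{kj}-\delta^j_l\Lambda^{ik},$$ $$[h^i_{\;j},h^k_{\;l}]=\delta^i_lh^k_{\;j}-\delta^k_jh^i_{\;l},\qquad[\Lambda^{ij},\Lambda^{kl}]=0,\qquad[L_{ij},L_{kl}]=0.$$ Consequently $\mathcal{B}_g/O_n$ is a representation of the Lie algebra $\mathfrak{sp}(g)=\mathfrak{sp}_{2g}(\mathbb{C})$ of $Sp(g)$: with $E_{ij}$ the $g\times g$ matrix units, there is a Lie algebra homomorphism $\rho:\mathfrak{sp}(g)\to\mathrm{End}(\mathcal{B}_g/O_n)$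 with $$\rho\begin{pmatrix}0&\frac12(E_{ij}+E_{ji})\\0&0\end{pmatrix}=L_{ij},\quad \rho\begin{pmatrix}0&0\\\frac12(E_{ij}+E_{ji})&0\end{pmatrix}=\Lambda^{ij},\quad \rho\begin{pmatrix}E_{ji}&0\\0&-E_{ij}\end{pmatrix}=h^i_{\;j}-n\delta^i_j.$$ This representation is reducible: it has an invariant subspace different from $0$ and from the whole space. Moreover $\rho$ extends to a representation by continuous operators on the completion of $\mathcal{B}_g/O_n$ with respect to the total degree (half the number of vertices), and this representation has a closed invariant subspace different from $0$ and from the whole space. -/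

import Mathlib

-- The commutator bracket on associative algebras, as for endomorphism algebras.
attribute [local instance 100] LieRing.ofAssociativeRing

/-- The half-edges of a uni-trivalent graph with trivalent vertices `V` and univalent vertices `U`:
the half-edges `(v, 0), (v, 1), (v, 2)` at each trivalent vertex `v`, and one at each univalent
vertex. -/
abbrev HalfEdge (V U : Type) : Type := (V × Fin 3) ⊕ U

/-- A finite oriented uni-trivalent graph (possibly empty or disconnected, loops and multiple edges
allowed) with univalent vertices marked by elements of `Fin g`, together with a finite number of
vertex-free circles.
The edges are the orbits of the fixed-point-free involution `glue` on half-edges.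
The orientation at a trivalent vertex `v` is the cyclic order `(v, 0), (v, 1), (v, 2)`. -/
structure MarkedGraph (g : ℕ) : Type 1 where
  V : Type
  U : Type
  [fintypeV : Fintype V]
  [fintypeU : Fintype U]
  glue : HalfEdge V U → HalfEdge V U
  glue_glue : ∀ x, glue (glue x) = x
  glue_ne : ∀ x, glue x ≠ x
  label : U → Fin g
  circles : ℕ

attribute [instance] MarkedGraph.fintypeV MarkedGraph.fintypeU

namespace MarkedGraph

variable {g : ℕ}

/-- Isomorphism of oriented marked graphs: bijections of trivalent and of univalent vertices, and
at each trivalent vertex a rotation of the three half-edges, which respect the edges, the markings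
and the number of circles. -/
def Iso (D E : MarkedGraph g) : Prop :=
  ∃ (eV : D.V ≃ E.V) (eU : D.U ≃ E.U) (r : D.V → Fin 3),
    (∀ x, Sum.map (fun p : D.V × Fin 3 => (eV p.1, p.2 + r p.1)) eU (D.glue x) =
      E.glue (Sum.map (fun p : D.V × Fin 3 => (eV p.1, p.2 + r p.1)) eU x)) ∧
    (∀ u, E.label (eU u) = D.label u) ∧ E.circles = D.circles

/-- The graph with one more circle. -/
def addCircle (D : MarkedGraph g) : MarkedGraph g := { D with circles := D.circles + 1 }

/-- Reattach the ends of edges: whatever was attached at the half-edge `x` is now attached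
at `π x`. -/
def reattach (D : MarkedGraph g) (π : Equiv.Perm (HalfEdge D.V D.U)) : MarkedGraph g :=
  { D with
    glue := fun x => π (D.glue (π.symm x))
    glue_glue := fun x => by simp [D.glue_glue]
    glue_ne := fun x hx => D.glue_ne (π.symm x) (π.injective (by simpa using hx)) }

open Classical in
/-- The graph with the orientation reversed at the trivalent vertex `v`. -/
noncomputable def flip (D : MarkedGraph g) (v : D.V) : MarkedGraph g :=
  D.reattach (Equiv.swap (Sum.inl (v, 1)) (Sum.inl (v, 2)))

open Classical in
/-- The three-cycle `(v, 1) ↦ (v, 2) ↦ (w, 1) ↦ (v, 1)` of half-edges. -/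
noncomputable def ihxPerm (D : MarkedGraph g) (v w : D.V) : Equiv.Perm (HalfEdge D.V D.U) :=
  Equiv.swap (Sum.inl (v, 1)) (Sum.inl (v, 2)) * Equiv.swap (Sum.inl (v, 2)) (Sum.inl (w, 1))

/-- Disjoint union with a single edge whose two univalent ends are marked `i` and `j`. -/
def addChord (D : MarkedGraph g) (i j : Fin g) : MarkedGraph g where
  V := D.V
  U := D.U ⊕ Fin 2
  glue := fun x => match x with
    | Sum.inl f => Sum.map id Sum.inl (D.glue (Sum.inl f))
    | Sum.inr (Sum.inl u) => Sum.map id Sum.inl (D.glue (Sum.inr u))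
    | Sum.inr (Sum.inr k) => Sum.inr (Sum.inr (1 - k))
  glue_glue := fun x => by
    rcases x with f | u | k
    · have h := D.glue_glue (Sum.inl f)
      dsimp only
      generalize D.glue (Sum.inl f) = y at h ⊢
      rcases y with f' | u' <;> simp [h]
    · have h := D.glue_glue (Sum.inr u)
      dsimp only
      generalize D.glue (Sum.inr u) = y at h ⊢
      rcases y with f' | u' <;> simp [h]
    · simp
  glue_ne := fun x => by
    rcases x with f | u | k
    · have h := D.glue_ne (Sum.inl f)
      rcases hx : D.glue (Sum.inl f) with f' | u' <;> rw [hx] at h <;> simp_all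
    · have h := D.glue_ne (Sum.inr u)
      rcases hx : D.glue (Sum.inr u) with f' | u' <;> rw [hx] at h <;> simp_all
    · fin_cases k <;> simp
  label := Sum.elim D.label ![i, j]
  circles := D.circles

open Classical in
/-- Change the marking of the univalent vertex `u` to `j`. -/
noncomputable def relabel (D : MarkedGraph g) (u : D.U) (j : Fin g) : MarkedGraph g :=
  { D with label := Function.update D.label u j }

open Classical in
/-- The half-edge to which `x` is attached once the edges ending at `a` and `b` are joined. -/
noncomputable def reroute (D : MarkedGraph g) (a b : D.U) (x : HalfEdge D.V D.U) : HalfEdge D.V D.U :=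
  if D.glue x = Sum.inr a then D.glue (Sum.inr b)
  else if D.glue x = Sum.inr b then D.glue (Sum.inr a)
  else D.glue x

/-- The inclusion of the half-edges other than `a` and `b`. -/
def incl (D : MarkedGraph g) (a b : D.U) (x : HalfEdge D.V {u : D.U // u ≠ a ∧ u ≠ b}) :
    HalfEdge D.V D.U := Sum.map id Subtype.val x

theorem incl_ne (D : MarkedGraph g) (a b : D.U) (x : HalfEdge D.V {u : D.U // u ≠ a ∧ u ≠ b}) :
    D.incl a b x ≠ Sum.inr a ∧ D.incl a b x ≠ Sum.inr b := by
  rcases x with f | ⟨u, hu⟩ <;> simp [incl]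
  exact hu

theorem incl_injective (D : MarkedGraph g) (a b : D.U) : Function.Injective (D.incl a b) :=
  Function.injective_id.sumMap Subtype.val_injective

/-- A half-edge other than `a` and `b`, as an element of the remaining half-edges. -/
def restrict (D : MarkedGraph g) (a b : D.U) (x : HalfEdge D.V D.U)
    (hx : x ≠ Sum.inr a ∧ x ≠ Sum.inr b) : HalfEdge D.V {u : D.U // u ≠ a ∧ u ≠ b} :=
  match x, hx with
  | Sum.inl f, _ => Sum.inl f
  | Sum.inr u, hu => Sum.inr ⟨u, fun h => hu.1 (by rw [h]), fun h => hu.2 (by rw [h])⟩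

theorem incl_restrict (D : MarkedGraph g) (a b : D.U) (x : HalfEdge D.V D.U)
    (hx : x ≠ Sum.inr a ∧ x ≠ Sum.inr b) : D.incl a b (D.restrict a b x hx) = x := by
  rcases x with f | u <;> rfl

theorem glue_eq_iff (D : MarkedGraph g) (x y : HalfEdge D.V D.U) :
    D.glue x = y ↔ x = D.glue y :=
  ⟨fun h => by rw [← h, D.glue_glue], fun h => by rw [h, D.glue_glue]⟩

theorem reroute_ne (D : MarkedGraph g) (a b : D.U) (x : HalfEdge D.V D.U)
    (hx : x ≠ Sum.inr a ∧ x ≠ Sum.inr b) :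
    D.reroute a b x ≠ Sum.inr a ∧ D.reroute a b x ≠ Sum.inr b := by
  have ha := D.glue_ne (Sum.inr a)
  have hb := D.glue_ne (Sum.inr b)
  have h1 := D.glue_eq_iff x (Sum.inr a)
  have h2 := D.glue_eq_iff x (Sum.inr b)
  have h3 := D.glue_eq_iff (Sum.inr a) (Sum.inr b)
  unfold reroute
  split_ifs <;> grind

theorem reroute_reroute (D : MarkedGraph g) (a b : D.U) (hab : a ≠ b) (x : HalfEdge D.V D.U)
    (hx : x ≠ Sum.inr a ∧ x ≠ Sum.inr b) : D.reroute a b (D.reroute a b x) = x := by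
  have hg := D.glue_glue
  have ha := D.glue_ne (Sum.inr a)
  have hb := D.glue_ne (Sum.inr b)
  have h1 := D.glue_eq_iff x (Sum.inr a)
  have h2 := D.glue_eq_iff x (Sum.inr b)
  have hab' : (Sum.inr a : HalfEdge D.V D.U) ≠ Sum.inr b := fun h => hab (Sum.inr_injective h)
  unfold reroute
  split_ifs <;> grind

theorem reroute_ne_self (D : MarkedGraph g) (a b : D.U) (hab : a ≠ b) (x : HalfEdge D.V D.U) :
    D.reroute a b x ≠ x := by
  have hg := D.glue_glue
  have h0 := D.glue_ne x
  have hab' : (Sum.inr a : HalfEdge D.V D.U) ≠ Sum.inr b := fun h => hab (Sum.inr_injective h)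
  unfold reroute
  split_ifs <;> grind

open Classical in
/-- Remove the distinct univalent vertices `a` and `b` and join the two edges that ended there.
If these were the two ends of one edge, that edge becomes a circle. -/
noncomputable def join (D : MarkedGraph g) (a b : D.U) (hab : a ≠ b) : MarkedGraph g where
  V := D.V
  U := {u : D.U // u ≠ a ∧ u ≠ b}
  glue := fun x => D.restrict a b (D.reroute a b (D.incl a b x))
    (D.reroute_ne a b _ (D.incl_ne a b x))
  glue_glue := fun x => D.incl_injective a b (by
    rw [incl_restrict, incl_restrict, D.reroute_reroute a b hab _ (D.incl_ne a b x)])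
  glue_ne := fun x hx => D.reroute_ne_self a b hab (D.incl a b x) (by
    conv_rhs => rw [← hx]
    rw [incl_restrict])
  label := fun u => D.label u.1
  circles := D.circles + if D.glue (Sum.inr a) = Sum.inr b then 1 else 0

/-- The total degree: half the number of vertices (this number is always even). -/
def degree (D : MarkedGraph g) : ℕ := (Fintype.card D.V + Fintype.card D.U) / 2

end MarkedGraph

/-- The relations which say that isomorphic graphs are equal, together with AS and IHX. In IHX
the half-edges `(v, 0)` and `(w, 0)` form an edge between distinct trivalent vertices, and the
edges attached at `(v, 1)`, `(v, 2)`, `(w, 1)` are permuted cyclically. -/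
inductive GraphRel (g : ℕ) : (MarkedGraph g →₀ ℂ) → Prop
  | iso (D E : MarkedGraph g) (hDE : D.Iso E) :
      GraphRel g (Finsupp.single D 1 - Finsupp.single E 1)
  | as (D : MarkedGraph g) (v : D.V) :
      GraphRel g (Finsupp.single D 1 + Finsupp.single (D.flip v) 1)
  | ihx (D : MarkedGraph g) (v w : D.V) (hvw : v ≠ w)
      (hedge : D.glue (Sum.inl (v, 0)) = Sum.inl (w, 0)) :
      GraphRel g (Finsupp.single D 1 + Finsupp.single (D.reattach (D.ihxPerm v w)) 1 +
        Finsupp.single (D.reattach (D.ihxPerm v w)⁻¹) 1)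

/-- The space `B_g` of finite linear combinations of marked uni-trivalent graphs
modulo AS and IHX. -/
def GraphSpace (g : ℕ) : Type 1 :=
  (MarkedGraph g →₀ ℂ) ⧸ Submodule.span ℂ {x | GraphRel g x}

noncomputable instance (g : ℕ) : AddCommGroup (GraphSpace g) :=
  inferInstanceAs (AddCommGroup ((MarkedGraph g →₀ ℂ) ⧸ Submodule.span ℂ {x | GraphRel g x}))

noncomputable instance (g : ℕ) : Module ℂ (GraphSpace g) :=
  inferInstanceAs (Module ℂ ((MarkedGraph g →₀ ℂ) ⧸ Submodule.span ℂ {x | GraphRel g x}))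

/-- The class of a graph in `B_g`. -/
noncomputable def GraphSpace.mk {g : ℕ} (D : MarkedGraph g) : GraphSpace g :=
  (Submodule.span ℂ {x | GraphRel g x}).mkQ (Finsupp.single D 1)

/-- The relation `O_n`: a circle is the same as multiplication by `-2n`. -/
noncomputable def relO (g n : ℕ) : Submodule ℂ (GraphSpace g) :=
  Submodule.span ℂ (Set.range fun D : MarkedGraph g =>
    GraphSpace.mk D.addCircle + (2 * (n : ℂ)) • GraphSpace.mk D)

/-- The space `B_g / O_n`. -/
def GraphSpaceO (g n : ℕ) : Type 1 := GraphSpace g ⧸ relO g n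

noncomputable instance (g n : ℕ) : AddCommGroup (GraphSpaceO g n) :=
  inferInstanceAs (AddCommGroup (GraphSpace g ⧸ relO g n))

noncomputable instance (g n : ℕ) : Module ℂ (GraphSpaceO g n) :=
  inferInstanceAs (Module ℂ (GraphSpace g ⧸ relO g n))

/-- The class of a graph in `B_g / O_n`. -/
noncomputable def graphClass {g : ℕ} (n : ℕ) (D : MarkedGraph g) : GraphSpaceO g n :=
  (relO g n).mkQ (GraphSpace.mk D)

/-- The span of the graphs of total degree at least `d`. -/
noncomputable def degreeFiltration (g n d : ℕ) : Submodule ℂ (GraphSpaceO g n) :=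
  Submodule.span ℂ {x | ∃ D : MarkedGraph g, d ≤ D.degree ∧ x = graphClass n D}

theorem degreeFiltration_anti (g n : ℕ) {d e : ℕ} (hde : d ≤ e) :
    degreeFiltration g n e ≤ degreeFiltration g n d :=
  Submodule.span_mono fun _ ⟨D, hD, hx⟩ => ⟨D, hde.trans hD, hx⟩

/-- The completion of `B_g / O_n` with respect to the total degree: the inverse limit of the
quotients by the degree filtration. -/
noncomputable def completedGraphSpaceO (g n : ℕ) :
    Submodule ℂ (∀ d : ℕ, GraphSpaceO g n ⧸ degreeFiltration g n d) where
  carrier := {y | ∀ (d e : ℕ) (hde : d ≤ e),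
    Submodule.factor (degreeFiltration_anti g n hde) (y e) = y d}
  add_mem' := fun hx hy d e hde => by simp [hx d e hde, hy d e hde]
  zero_mem' := fun d e hde => by simp
  smul_mem' := fun c x hx d e hde => by simp [hx d e hde]

/-- The canonical map from `B_g / O_n` to its completion. -/
noncomputable def toCompleted (g n : ℕ) : GraphSpaceO g n →ₗ[ℂ] completedGraphSpaceO g n :=
  LinearMap.codRestrict _ (LinearMap.pi fun d => (degreeFiltration g n d).mkQ)
    (fun _ _ _ _ => rfl)

/-- Closedness of a subspace of the completion in the inverse limit topology. -/
def IsClosedSubspace {g n : ℕ} (S : Submodule ℂ (completedGraphSpaceO g n)) : Prop :=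
  ∀ y : completedGraphSpaceO g n, (∀ d, ∃ s ∈ S, s.1 d = y.1 d) → y ∈ S

/-- The symmetric matrix `(E_ij + E_ji) / 2`. -/
noncomputable def symUnit {g : ℕ} (i j : Fin g) : Matrix (Fin g) (Fin g) ℂ :=
  (1 / 2 : ℂ) • (Matrix.single i j 1 + Matrix.single j i 1)

theorem symUnit_transpose {g : ℕ} (i j : Fin g) : (symUnit i j).transpose = symUnit i j := by
  simp [symUnit, add_comm]

/-- The element of the Lie algebra `sp(g)` of `2g × 2g` matrices with upper right block
`(E_ij + E_ji) / 2` and other blocks zero. -/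
noncomputable def spL {g : ℕ} (i j : Fin g) : LieAlgebra.Symplectic.sp (Fin g) ℂ :=
  ⟨Matrix.fromBlocks 0 (symUnit i j) 0 0, by
    simp [LieAlgebra.Symplectic.sp, Matrix.IsSkewAdjoint, Matrix.IsAdjointPair, Matrix.J,
      Matrix.fromBlocks_transpose, Matrix.fromBlocks_multiply, Matrix.fromBlocks_neg,
      symUnit_transpose]⟩

/-- The element of `sp(g)` with lower left block `(E_ij + E_ji) / 2` and other blocks zero. -/
noncomputable def spΛ {g : ℕ} (i j : Fin g) : LieAlgebra.Symplectic.sp (Fin g) ℂ :=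
  ⟨Matrix.fromBlocks 0 0 (symUnit i j) 0, by
    simp [LieAlgebra.Symplectic.sp, Matrix.IsSkewAdjoint, Matrix.IsAdjointPair, Matrix.J,
      Matrix.fromBlocks_transpose, Matrix.fromBlocks_multiply, Matrix.fromBlocks_neg,
      symUnit_transpose]⟩

/-- The element of `sp(g)` with diagonal blocks `E_ji` and `-E_ij`, and other blocks zero. -/
noncomputable def spH {g : ℕ} (i j : Fin g) : LieAlgebra.Symplectic.sp (Fin g) ℂ :=
  ⟨Matrix.fromBlocks (Matrix.single j i 1) 0 0 (-Matrix.single i j 1), by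
    simp [LieAlgebra.Symplectic.sp, Matrix.IsSkewAdjoint, Matrix.IsAdjointPair, Matrix.J,
      Matrix.fromBlocks_transpose, Matrix.fromBlocks_multiply, Matrix.fromBlocks_neg]⟩

/-- The Kronecker delta. -/
def kron {g : ℕ} (i j : Fin g) : ℂ := if i = j then 1 else 0

/-! The operators change only univalent vertices, while AS and IHX change only how edges are
attached at trivalent ones. Both relations permute trivalent half-edges, and `reattachT` records
this. Adding a chord, relabelling an end and joining two ends all commute with such a permutation
(`addChord_reattachT`, `join_reattachT`). Each sum over ends therefore respects the relations term
by term, and `IsGraphInvariant.lift` makes it an operator on the quotient.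

The commutators count the ways in which two operations interact. For `Λ` after `L`, two old ends
give `L` after `Λ`. An old end joined to a chord end is merely relabelled, which gives the `h`
terms. The two chord ends joined to each other give a circle, hence the factor `-2n` and, after
multiplication by `-1/4`, the scalar `n/2` (`joinSum_addChord`). For `h` with `h` or `Λ`, the
surviving terms are those where the relabelled end is used twice (`opH_opH_graphClass`,
`sum_joinSum_relabel`). Joins of disjoint pairs of ends commute (`join_join`). Shifting `h` by `-n`
on the diagonal absorbs the scalar. Then `rho` only has to be checked block by block on matrix
units.

All relations and operators preserve the trivalent vertices, so the projection `chordProj` onto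
graphs without them commutes with `rho`, and its kernel is invariant. The kernel contains the theta
graph and does not contain the empty graph, so properness requires both classes to be nonzero. This
is detected by the weight system that contracts Levi-Civita tensors, where IHX is the Jacobi
identity for the cross product (`levi_jacobi`, `weight_ihx`) and the theta graph gives a sum of
squares.

For the completion, the operators lower the degree by at most one and so extend level by level. The
weight functional restricted to `k` trivalent vertices kills high degree, so the two classes remain
nonzero. The kernel of the extended projection is closed because that projection is continuous. -/

namespace MarkedGraph

/-! ### Isomorphisms of graphs and reattachment at trivalent half-edges. -/

variable {g : ℕ}

/-- The map of half-edges underlying an isomorphism of graphs. -/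
def isoMap {D E : MarkedGraph g} (eV : D.V ≃ E.V) (eU : D.U ≃ E.U) (r : D.V → Fin 3) :
    HalfEdge D.V D.U → HalfEdge E.V E.U :=
  Sum.map (fun p : D.V × Fin 3 => (eV p.1, p.2 + r p.1)) eU

theorem isoMap_injective {D E : MarkedGraph g} (eV : D.V ≃ E.V) (eU : D.U ≃ E.U)
    (r : D.V → Fin 3) : Function.Injective (isoMap eV eU r) := by
  refine Function.Injective.sumMap ?_ eU.injective
  rintro ⟨v, k⟩ ⟨w, l⟩ h
  simp only [Prod.mk.injEq, EmbeddingLike.apply_eq_iff_eq] at h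
  obtain ⟨rfl, h⟩ := h
  simpa using h

/-- Isomorphism from bijections which respect the edges without rotating trivalent vertices. -/
theorem Iso.of_equiv {D E : MarkedGraph g} (eV : D.V ≃ E.V) (eU : D.U ≃ E.U)
    (hg : ∀ x, Sum.map (Prod.map eV id) eU (D.glue x) =
      E.glue (Sum.map (Prod.map eV id) eU x))
    (hl : ∀ u, E.label (eU u) = D.label u) (hc : E.circles = D.circles) : D.Iso E := by
  refine ⟨eV, eU, fun _ => 0, ?_, hl, hc⟩
  have : (fun p : D.V × Fin 3 => (eV p.1, p.2 + 0)) = Prod.map eV id := by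
    ext p <;> simp
  rw [this]
  exact hg

/-- Isomorphism of graphs with the same half-edges. -/
theorem Iso.of_eq {V U : Type} [Fintype V] [Fintype U] {V' : Fintype V} {U' : Fintype U}
    {s t : HalfEdge V U → HalfEdge V U} {hs ht hs' ht'} {l m : U → Fin g} {c d : ℕ}
    (h : s = t) (hl : l = m) (hc : c = d) :
    Iso (@mk g V U _ _ s hs hs' l c) (@mk g V U V' U' t ht ht' m d) := by
  subst h hl hc
  exact Iso.of_equiv (Equiv.refl V) (Equiv.refl U) (fun x => by rcases x with x | x <;> simp)
    (fun u => rfl) rfl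

/-- Reattach the ends of edges at trivalent vertices. -/
abbrev reattachT (D : MarkedGraph g) (p : Equiv.Perm (D.V × Fin 3)) : MarkedGraph g :=
  D.reattach (Equiv.Perm.sumCongr p (Equiv.refl D.U))

-- The permutation in AS moves trivalent half-edges only, so it makes sense on every graph with the
-- same trivalent vertices. This allows it to be compared before and after an operation on univalent
-- vertices.
open Classical in
theorem flip_eq (D : MarkedGraph g) (v : D.V) :
    D.flip v = D.reattachT (Equiv.swap (v, 1) (v, 2)) := by
  unfold reattachT
  rw [show Equiv.refl D.U = 1 from rfl, Equiv.Perm.sumCongr_swap_one]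
  rfl

open Classical in
/-- The three-cycle of half-edges in the relation IHX. -/
noncomputable def ihxPermT (D : MarkedGraph g) (v w : D.V) : Equiv.Perm (D.V × Fin 3) :=
  Equiv.swap (v, 1) (v, 2) * Equiv.swap (v, 2) (w, 1)

theorem ihxPerm_eq (D : MarkedGraph g) (v w : D.V) :
    D.ihxPerm v w = Equiv.Perm.sumCongr (D.ihxPermT v w) (Equiv.refl D.U) := by
  classical
  rw [show Equiv.refl D.U = 1 * 1 from rfl, ihxPermT, ← Equiv.Perm.sumCongr_mul,
    Equiv.Perm.sumCongr_swap_one, Equiv.Perm.sumCongr_swap_one]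
  rfl

theorem ihxPerm_inv_eq (D : MarkedGraph g) (v w : D.V) :
    (D.ihxPerm v w)⁻¹ = Equiv.Perm.sumCongr (D.ihxPermT v w)⁻¹ (Equiv.refl D.U) := by
  rw [ihxPerm_eq, Equiv.Perm.sumCongr_inv]; rfl

/-! ### Compatibility of the operations on graphs with isomorphisms -/

/-- The half-edges of a graph as half-edges of its disjoint union with an edge. -/
def chordIncl (D : MarkedGraph g) (i j : Fin g) :
    HalfEdge D.V D.U → HalfEdge (D.addChord i j).V (D.addChord i j).U :=
  Sum.map id Sum.inl

theorem addChord_glue (D : MarkedGraph g) (i j : Fin g) (x : HalfEdge D.V D.U) :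
    (D.addChord i j).glue (D.chordIncl i j x) = D.chordIncl i j (D.glue x) := by
  rcases x with x | x <;> rfl

theorem Iso.addChord {D E : MarkedGraph g} (h : D.Iso E) (i j : Fin g) :
    (D.addChord i j).Iso (E.addChord i j) := by
  obtain ⟨eV, eU, r, hg, hl, hc⟩ := h
  let φ := isoMap (D := D.addChord i j) (E := E.addChord i j) eV
    (Equiv.sumCongr eU (Equiv.refl (Fin 2))) r
  have hφ : ∀ x, φ (D.chordIncl i j x) = E.chordIncl i j (isoMap eV eU r x) := by
    rintro (x | x) <;> rfl
  have main : ∀ x, φ ((D.addChord i j).glue (D.chordIncl i j x)) =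
      (E.addChord i j).glue (φ (D.chordIncl i j x)) := fun x => by
    rw [addChord_glue, hφ, hφ, addChord_glue]
    exact congrArg _ (hg x)
  refine ⟨eV, Equiv.sumCongr eU (Equiv.refl (Fin 2)), r, ?_, ?_, hc⟩
  · rintro (f | u | k)
    · exact main (Sum.inl f)
    · exact main (Sum.inr u)
    · rfl
  · rintro (u | k)
    · exact hl u
    · rfl

theorem relabel_iso {D E : MarkedGraph g} (eV : D.V ≃ E.V) (eU : D.U ≃ E.U) (r : D.V → Fin 3)
    (hg : ∀ x, isoMap eV eU r (D.glue x) = E.glue (isoMap eV eU r x))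
    (hl : ∀ u, E.label (eU u) = D.label u) (hc : E.circles = D.circles) (u : D.U) (j : Fin g) :
    (D.relabel u j).Iso (E.relabel (eU u) j) := by
  classical
  refine ⟨eV, eU, r, hg, fun (w : D.U) => ?_, hc⟩
  change Function.update E.label (eU u) j (eU w) = Function.update D.label u j w
  simp only [Function.update_apply, eU.injective.eq_iff, hl]

/-- `reroute` is defined by equality tests between half-edges, and an injective map that respects
edges preserves these tests. -/
theorem join_iso {D E : MarkedGraph g} (eV : D.V ≃ E.V) (eU : D.U ≃ E.U) (r : D.V → Fin 3)
    (hg : ∀ x, isoMap eV eU r (D.glue x) = E.glue (isoMap eV eU r x))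
    (hl : ∀ u, E.label (eU u) = D.label u) (hc : E.circles = D.circles) (a b : D.U) (hab : a ≠ b) :
    (D.join a b hab).Iso (E.join (eU a) (eU b) (eU.injective.ne hab)) := by
  classical
  have hinj := isoMap_injective eV eU r
  have ha : isoMap eV eU r (Sum.inr a) = Sum.inr (eU a) := rfl
  have hb : isoMap eV eU r (Sum.inr b) = Sum.inr (eU b) := rfl
  have hre : ∀ x, isoMap eV eU r (D.reroute a b x) =
      E.reroute (eU a) (eU b) (isoMap eV eU r x) := by
    intro x
    simp only [reroute, ← ha, ← hb, ← hg, hinj.eq_iff]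
    split_ifs <;> rfl
  let e : {u : D.U // u ≠ a ∧ u ≠ b} ≃ {u : E.U // u ≠ eU a ∧ u ≠ eU b} :=
    eU.subtypeEquiv (fun u => by simp)
  have hincl : ∀ x, E.incl (eU a) (eU b) (isoMap (D := D.join a b hab)
      (E := E.join (eU a) (eU b) (eU.injective.ne hab)) eV e r x) =
      isoMap eV eU r (D.incl a b x) := by
    rintro (x | x) <;> rfl
  refine ⟨eV, e, r, fun x => E.incl_injective (eU a) (eU b) ?_, fun u => hl u.1, ?_⟩
  · refine (hincl _).trans ?_
    simp only [join]
    rw [incl_restrict, incl_restrict, hre, ← hincl]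
    rfl
  · simp only [join, ← ha, ← hb, ← hg, hinj.eq_iff, hc]

/-! ### Compatibility with reattaching at trivalent vertices -/

theorem addChord_reattachT (D : MarkedGraph g) (p : Equiv.Perm (D.V × Fin 3)) (i j : Fin g) :
    ((D.reattachT p).addChord i j).Iso ((D.addChord i j).reattachT p) := by
  have main : ∀ x : HalfEdge D.V D.U,
      ((D.reattachT p).addChord i j).glue (D.chordIncl i j x) =
        ((D.addChord i j).reattachT p).glue (D.chordIncl i j x) := by
    intro x
    have h1 : ∀ x, D.chordIncl i j (Equiv.Perm.sumCongr p (Equiv.refl D.U) x) =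
        Equiv.Perm.sumCongr p (Equiv.refl (D.addChord i j).U) (D.chordIncl i j x) := by
      rintro (x | x) <;> rfl
    have h2 : ∀ x, D.chordIncl i j ((Equiv.Perm.sumCongr p (Equiv.refl D.U)).symm x) =
        (Equiv.Perm.sumCongr p (Equiv.refl (D.addChord i j).U)).symm (D.chordIncl i j x) := by
      rintro (x | x) <;> rfl
    refine ((D.reattachT p).addChord_glue i j x).trans ((h1 _).trans (congrArg _ ?_))
    exact (D.addChord_glue i j _).symm.trans (congrArg _ (h2 x))
  refine Iso.of_eq ?_ rfl rfl
  funext x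
  rcases x with f | u | k
  · exact main (Sum.inl f)
  · exact main (Sum.inr u)
  · rfl

/-- Reattachment conjugates `glue` by a permutation that fixes the ends `a` and `b`, so the
conjugation passes through `reroute` and does not affect whether a circle is created. -/
theorem join_reattachT (D : MarkedGraph g) (p : Equiv.Perm (D.V × Fin 3)) (a b : D.U)
    (hab : a ≠ b) :
    ((D.reattachT p).join a b hab).Iso ((D.join a b hab).reattachT p) := by
  classical
  set q : Equiv.Perm (HalfEdge D.V D.U) := Equiv.Perm.sumCongr p (Equiv.refl D.U) with hq
  have ha : ∀ y, q y = Sum.inr a ↔ y = Sum.inr a := by rintro (y | y) <;> simp [hq]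
  have hb : ∀ y, q y = Sum.inr b ↔ y = Sum.inr b := by rintro (y | y) <;> simp [hq]
  have ha' : q.symm (Sum.inr a) = Sum.inr a := by simp [hq]
  have hb' : q.symm (Sum.inr b) = Sum.inr b := by simp [hq]
  refine Iso.of_eq ?_ rfl ?_
  · funext x
    apply D.incl_injective a b
    have h1 : ∀ x, D.incl a b (Equiv.Perm.sumCongr p (Equiv.refl {u : D.U // u ≠ a ∧ u ≠ b}) x) =
        q (D.incl a b x) := by rintro (x | x) <;> rfl
    have h2 : ∀ x, D.incl a b ((Equiv.Perm.sumCongr p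
        (Equiv.refl {u : D.U // u ≠ a ∧ u ≠ b})).symm x) = q.symm (D.incl a b x) := by
      rintro (x | x) <;> rfl
    refine ((D.reattachT p).incl_restrict a b _ _).trans ?_
    refine Eq.trans ?_ (h1 _).symm
    refine Eq.trans ?_ (congrArg q (D.incl_restrict a b _ _).symm)
    refine Eq.trans ?_ (congrArg (fun y => q (D.reroute a b y)) (h2 x).symm)
    have hre : ∀ y : HalfEdge D.V D.U, (D.reattachT p).reroute a b y = q (D.reroute a b (q.symm y)) := by
      intro y
      change (if q (D.glue (q.symm y)) = Sum.inr a then q (D.glue (q.symm (Sum.inr b)))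
        else if q (D.glue (q.symm y)) = Sum.inr b then q (D.glue (q.symm (Sum.inr a)))
        else q (D.glue (q.symm y))) = _
      simp only [ha', hb', reroute, ha, hb]
      split_ifs <;> rfl
    exact hre _
  · change D.circles + (if q (D.glue (q.symm (Sum.inr a))) = Sum.inr b then 1 else 0) =
      D.circles + (if D.glue (Sum.inr a) = Sum.inr b then 1 else 0)
    simp only [ha', hb]

/-! ### Effect of the operations on the total degree. -/

theorem degree_join (D : MarkedGraph g) (a b : D.U) (hab : a ≠ b) :
    (D.join a b hab).degree + 1 = D.degree := by
  classical
  have : Fintype.card (D.join a b hab).U + 2 = Fintype.card D.U := by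
    have h1 : Fintype.card (D.join a b hab).U = Fintype.card {u : D.U // ¬ (u = a ∨ u = b)} :=
      Fintype.card_congr (Equiv.subtypeEquivRight fun u => by simp)
    rw [h1, Fintype.card_subtype_compl, Fintype.card_subtype_eq_or_eq_of_ne hab]
    have : 1 < Fintype.card D.U := Fintype.one_lt_card_iff.mpr ⟨a, b, hab⟩
    omega
  unfold degree
  have hV : Fintype.card (D.join a b hab).V = Fintype.card D.V := rfl
  omega

theorem degree_addChord (D : MarkedGraph g) (i j : Fin g) :
    (D.addChord i j).degree = D.degree + 1 := by
  have hU : Fintype.card (D.addChord i j).U = Fintype.card D.U + 2 := by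
    change Fintype.card (D.U ⊕ Fin 2) = _
    simp
  have hV : Fintype.card (D.addChord i j).V = Fintype.card D.V := rfl
  unfold degree
  omega

end MarkedGraph

/-! ### Graph invariants and the universal property of the quotient. -/

open MarkedGraph

variable {g : ℕ}

/-- A function on graphs with values in a vector space which respects isomorphisms and the relations
AS, IHX and `O_n`. -/
structure IsGraphInvariant {M : Type*} [AddCommGroup M] [Module ℂ M] (n : ℕ)
    (f : MarkedGraph g → M) : Prop where
  iso : ∀ {D E : MarkedGraph g}, D.Iso E → f D = f E
  as : ∀ (D : MarkedGraph g) (v : D.V), f D + f (D.flip v) = 0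
  ihx : ∀ (D : MarkedGraph g) (v w : D.V), v ≠ w →
    D.glue (Sum.inl (v, 0)) = Sum.inl (w, 0) →
    f D + f (D.reattach (D.ihxPerm v w)) + f (D.reattach (D.ihxPerm v w)⁻¹) = 0
  circle : ∀ D : MarkedGraph g, f D.addCircle + (2 * (n : ℂ)) • f D = 0

theorem graphClass_isGraphInvariant (n : ℕ) :
    IsGraphInvariant n (graphClass n : MarkedGraph g → GraphSpaceO g n) := by
  have key : ∀ x, GraphRel g x → (relO g n).mkQ ((Submodule.span ℂ {x | GraphRel g x}).mkQ x) = 0 := by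
    intro x hx
    have : (Submodule.span ℂ {x | GraphRel g x}).mkQ x = 0 :=
      (Submodule.Quotient.mk_eq_zero _).2 (Submodule.subset_span hx)
    rw [this]
    exact map_zero (relO g n).mkQ
  refine ⟨fun {D E} h => ?_, fun D v => ?_, fun D v w hvw he => ?_, fun D => ?_⟩
  · rw [← sub_eq_zero]
    exact key _ (.iso D E h)
  · exact key _ (.as D v)
  · exact key _ (.ihx D v w hvw he)
  · exact (Submodule.Quotient.mk_eq_zero (relO g n)).2 (Submodule.subset_span ⟨D, rfl⟩)

section lift

variable {M : Type*} [AddCommGroup M] [Module ℂ M] {n : ℕ}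

/-- The linear map on `B_g / O_n` defined by a function on graphs. -/
noncomputable def IsGraphInvariant.lift {f : MarkedGraph g → M} (hf : IsGraphInvariant n f) :
    GraphSpaceO g n →ₗ[ℂ] M :=
  Submodule.liftQ (relO g n)
    (Submodule.liftQ (Submodule.span ℂ {x | GraphRel g x}) (Finsupp.linearCombination ℂ f) (by
      rw [Submodule.span_le]
      rintro _ (⟨D, E, h⟩ | ⟨D, v⟩ | ⟨D, v, w, hvw, he⟩)
      · simp [hf.iso h]
      · simpa using hf.as D v
      · simpa using hf.ihx D v w hvw he) : GraphSpace g →ₗ[ℂ] M) (by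
    rw [relO, Submodule.span_le]
    rintro _ ⟨D, rfl⟩
    have h : ∀ D : MarkedGraph g, Submodule.liftQ (Submodule.span ℂ {x | GraphRel g x})
        (Finsupp.linearCombination ℂ f) (by
          rw [Submodule.span_le]
          rintro _ (⟨D, E, h⟩ | ⟨D, v⟩ | ⟨D, v, w, hvw, he⟩)
          · simp [hf.iso h]
          · simpa using hf.as D v
          · simpa using hf.ihx D v w hvw he) (GraphSpace.mk D) = f D := by
      intro D
      refine (Submodule.liftQ_apply _ _ _).trans ?_
      simp
    refine LinearMap.mem_ker.2 ?_
    refine (map_add _ _ _).trans ?_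
    refine (congrArg₂ (· + ·) (h _) ((map_smul _ _ _).trans (congrArg _ (h _)))).trans ?_
    exact hf.circle D)

@[simp]
theorem IsGraphInvariant.lift_graphClass {f : MarkedGraph g → M} (hf : IsGraphInvariant n f)
    (D : MarkedGraph g) : hf.lift (graphClass n D) = f D := by
  refine (Submodule.liftQ_apply _ _ _).trans ((Submodule.liftQ_apply _ _ _).trans ?_)
  simp

theorem span_range_graphClass :
    Submodule.span ℂ (Set.range (graphClass n : MarkedGraph g → GraphSpaceO g n)) = ⊤ := by
  rw [eq_top_iff]
  intro x _
  obtain ⟨y, rfl⟩ := (relO g n).mkQ_surjective x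
  obtain ⟨z, rfl⟩ := (Submodule.span ℂ {x | GraphRel g x}).mkQ_surjective y
  induction z using Finsupp.induction_linear with
  | zero => exact Submodule.zero_mem (Submodule.span ℂ (Set.range (graphClass n)))
  | add a b ha hb =>
    exact Submodule.add_mem (Submodule.span ℂ (Set.range (graphClass n))) (ha trivial) (hb trivial)
  | single D c =>
    have : Finsupp.single D c = c • Finsupp.single D (1 : ℂ) := by simp
    rw [this]
    exact Submodule.smul_mem (Submodule.span ℂ (Set.range (graphClass n))) c
      (Submodule.subset_span (Set.mem_range_self D))

/-- Classes of graphs span the quotient, so every operator identity below is checked on a single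
graph. -/
theorem GraphSpaceO.hom_ext {S T : GraphSpaceO g n →ₗ[ℂ] M}
    (h : ∀ D, S (graphClass n D) = T (graphClass n D)) : S = T :=
  LinearMap.ext_on_range span_range_graphClass h

end lift

/-! ### The operators -/

section operators

variable {n : ℕ}

/-- Version of the relations for reattachment at trivalent vertices only. -/
theorem IsGraphInvariant.of_reattachT {M : Type*} [AddCommGroup M] [Module ℂ M]
    {f : MarkedGraph g → M} (iso : ∀ {D E : MarkedGraph g}, D.Iso E → f D = f E)
    (as : ∀ (D : MarkedGraph g) (v : D.V), open Classical in
      f D + f (D.reattachT (Equiv.swap (v, 1) (v, 2))) = 0)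
    (ihx : ∀ (D : MarkedGraph g) (v w : D.V), v ≠ w →
      D.glue (Sum.inl (v, 0)) = Sum.inl (w, 0) →
      f D + f (D.reattachT (D.ihxPermT v w)) + f (D.reattachT (D.ihxPermT v w)⁻¹) = 0)
    (circle : ∀ D : MarkedGraph g, f D.addCircle + (2 * (n : ℂ)) • f D = 0) :
    IsGraphInvariant n f where
  iso := iso
  as := fun D v => by rw [flip_eq]; exact as D v
  ihx := fun D v w hvw he => by rw [ihxPerm_inv_eq, ihxPerm_eq]; exact ihx D v w hvw he
  circle := circle

theorem graphClass_as (D : MarkedGraph g) (v : D.V) : open Classical in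
    graphClass n D + graphClass n (D.reattachT (Equiv.swap (v, 1) (v, 2))) = 0 := by
  rw [← flip_eq]
  exact (graphClass_isGraphInvariant n).as D v

theorem graphClass_ihx (D : MarkedGraph g) (v w : D.V) (hvw : v ≠ w)
    (he : D.glue (Sum.inl (v, 0)) = Sum.inl (w, 0)) :
    graphClass n D + graphClass n (D.reattachT (D.ihxPermT v w)) +
      graphClass n (D.reattachT (D.ihxPermT v w)⁻¹) = 0 := by
  have := (graphClass_isGraphInvariant n).ihx D v w hvw he
  rwa [ihxPerm_inv_eq, ihxPerm_eq] at this

theorem graphClass_circle (D : MarkedGraph g) :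
    graphClass n D.addCircle + (2 * (n : ℂ)) • graphClass n D = 0 :=
  (graphClass_isGraphInvariant n).circle D

theorem graphClass_iso {D E : MarkedGraph g} (h : D.Iso E) : graphClass n D = graphClass n E :=
  (graphClass_isGraphInvariant n).iso h

theorem addChord_isGraphInvariant (n : ℕ) (i j : Fin g) :
    IsGraphInvariant n fun D : MarkedGraph g => graphClass n (D.addChord i j) := by
  refine .of_reattachT (fun h => graphClass_iso (h.addChord i j)) (fun D v => ?_)
    (fun D v w hvw he => ?_) (fun D => ?_)
  · rw [graphClass_iso (addChord_reattachT D _ i j)]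
    exact graphClass_as (D.addChord i j) v
  · rw [graphClass_iso (addChord_reattachT D _ i j), graphClass_iso (addChord_reattachT D _ i j)]
    exact graphClass_ihx (D.addChord i j) v w hvw (by
      refine (D.addChord_glue i j (Sum.inl (v, 0))).trans ?_
      rw [he]; rfl)
  · refine Eq.trans ?_ (graphClass_circle (D.addChord i j))
    refine congrArg (· + _) (graphClass_iso (Iso.of_eq ?_ rfl rfl))
    funext x
    rcases x with x | x | x <;> rfl

-- The graphs in one AS, IHX or circle relation have the same univalent vertices with the same
-- markings. The sums are therefore over one index set and the relation holds term by term.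
open Classical in
theorem relabelSum_isGraphInvariant (n : ℕ) (i j : Fin g) :
    IsGraphInvariant n fun D : MarkedGraph g =>
      ∑ u : D.U, if D.label u = i then graphClass n (D.relabel u j) else 0 := by
  refine .of_reattachT ?_ (fun D v => ?_) (fun D v w hvw he => ?_) (fun D => ?_)
  · rintro D E ⟨eV, eU, r, hg, hl, hc⟩
    refine Fintype.sum_equiv eU _ _ fun u => ?_
    rw [hl, graphClass_iso (relabel_iso eV eU r hg hl hc u j)]
  · refine (Finset.sum_add_distrib (s := (Finset.univ : Finset D.U))).symm.trans ?_
    refine Finset.sum_eq_zero fun u _ => ?_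
    have := graphClass_as (n := n) (D.relabel u j) v
    change ite (D.label u = i) _ _ + ite (D.label u = i) _ _ = _
    split_ifs
    · exact this
    · simp
  · refine (congrArg (· + _) (Finset.sum_add_distrib (s := (Finset.univ : Finset D.U))).symm).trans ?_
    refine (Finset.sum_add_distrib (s := (Finset.univ : Finset D.U))).symm.trans ?_
    refine Finset.sum_eq_zero fun u _ => ?_
    have := graphClass_ihx (n := n) (D.relabel u j) v w hvw he
    change ite (D.label u = i) _ _ + ite (D.label u = i) _ _ + ite (D.label u = i) _ _ = _
    split_ifs
    · exact this
    · simp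
  · refine (congrArg (_ + ·) Finset.smul_sum).trans ?_
    refine (Finset.sum_add_distrib (s := (Finset.univ : Finset D.U))).symm.trans ?_
    refine Finset.sum_eq_zero fun u _ => ?_
    have := graphClass_circle (n := n) (D.relabel u j)
    change ite (D.label u = i) _ _ + (2 * (n : ℂ)) • ite (D.label u = i) _ _ = _
    split_ifs
    · exact this
    · simp

open Classical in
/-- The class of the graph with the edges ending at `a` and `b` joined, and zero if `a = b`. -/
noncomputable def joinClass (n : ℕ) (D : MarkedGraph g) (a b : D.U) : GraphSpaceO g n :=
  if hab : a ≠ b then graphClass n (D.join a b hab) else 0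

open Classical in
/-- The sum over all ways of joining an end marked `i` with an end marked `j`. -/
noncomputable def joinSum (n : ℕ) (i j : Fin g) (D : MarkedGraph g) : GraphSpaceO g n :=
  ∑ p : D.U × D.U, if D.label p.1 = i ∧ D.label p.2 = j then joinClass n D p.1 p.2 else 0

theorem MarkedGraph.join_glue_inl (D : MarkedGraph g) (a b : D.U) (hab : a ≠ b) (x y : D.V × Fin 3)
    (h : D.glue (Sum.inl x) = Sum.inl y) : (D.join a b hab).glue (Sum.inl x) = Sum.inl y := by
  apply D.incl_injective a b
  refine (D.incl_restrict a b _ _).trans ?_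
  change D.reroute a b (Sum.inl x) = Sum.inl y
  simp [reroute, h]

theorem joinClass_of_ne (D : MarkedGraph g) (a b : D.U) (hab : a ≠ b) :
    joinClass n D a b = graphClass n (D.join a b hab) := dif_pos hab

theorem joinClass_self (D : MarkedGraph g) (a : D.U) : joinClass n D a a = 0 :=
  dif_neg (fun h => h rfl)

theorem joinClass_reattachT (D : MarkedGraph g) (p : Equiv.Perm (D.V × Fin 3)) (a b : D.U)
    (hab : a ≠ b) :
    joinClass n (D.reattachT p) a b = graphClass n ((D.join a b hab).reattachT p) :=
  (joinClass_of_ne (D.reattachT p) a b hab).trans (graphClass_iso (join_reattachT D p a b hab))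

theorem joinClass_addCircle (D : MarkedGraph g) (a b : D.U) (hab : a ≠ b) :
    joinClass n D.addCircle a b = graphClass n (D.join a b hab).addCircle := by
  classical
  refine (joinClass_of_ne D.addCircle a b hab).trans (graphClass_iso (Iso.of_eq ?_ rfl ?_))
  · funext x
    apply D.incl_injective a b
    exact (D.addCircle.incl_restrict a b _ _).trans (D.incl_restrict a b _ _).symm
  · exact Nat.add_right_comm _ _ _

theorem joinClass_iso {D E : MarkedGraph g} (eV : D.V ≃ E.V) (eU : D.U ≃ E.U) (r : D.V → Fin 3)
    (hg : ∀ x, isoMap eV eU r (D.glue x) = E.glue (isoMap eV eU r x))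
    (hl : ∀ u, E.label (eU u) = D.label u) (hc : E.circles = D.circles) (a b : D.U) :
    joinClass n D a b = joinClass n E (eU a) (eU b) := by
  unfold joinClass
  by_cases hab : a = b
  · simp [hab]
  · have hab' : eU a ≠ eU b := eU.injective.ne hab
    simp only [ne_eq, hab, not_false_eq_true, hab', dite_true]
    exact graphClass_iso (join_iso eV eU r hg hl hc a b hab)

/-- As for relabelling, each relation is verified for a fixed pair of ends. Pairs with `a = b`
contribute zero, which keeps the sum over the full product free of dependent conditions. -/
theorem joinSum_isGraphInvariant (n : ℕ) (i j : Fin g) :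
    IsGraphInvariant n (joinSum n i j) := by
  classical
  refine .of_reattachT ?_ (fun D v => ?_) (fun D v w hvw he => ?_) (fun D => ?_)
  · rintro D E ⟨eV, eU, r, hg, hl, hc⟩
    refine Fintype.sum_equiv (eU.prodCongr eU) _ _ fun p => ?_
    simp only [Equiv.prodCongr_apply, Prod.map_fst, Prod.map_snd, hl]
    rw [joinClass_iso eV eU r hg hl hc]
  · refine (Finset.sum_add_distrib (s := (Finset.univ : Finset (D.U × D.U)))).symm.trans ?_
    refine Finset.sum_eq_zero fun p _ => ?_
    have : joinClass n D p.1 p.2 +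
        joinClass n (D.reattachT (Equiv.swap (v, 1) (v, 2))) p.1 p.2 = 0 := by
      obtain ⟨a, b⟩ := p
      by_cases h : a = b
      · subst h
        exact (congrArg₂ (· + ·) (joinClass_self D a)
          (joinClass_self (D.reattachT (Equiv.swap (v, 1) (v, 2))) a)).trans (add_zero 0)
      · exact (congrArg₂ (· + ·) (joinClass_of_ne D a b h)
          (joinClass_reattachT D _ a b h)).trans (graphClass_as (D.join a b h) v)
    change ite (D.label p.1 = i ∧ D.label p.2 = j) _ _ +
      ite (D.label p.1 = i ∧ D.label p.2 = j) _ _ = _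
    split_ifs
    · exact this
    · simp
  · refine (congrArg (· + _)
      (Finset.sum_add_distrib (s := (Finset.univ : Finset (D.U × D.U)))).symm).trans ?_
    refine (Finset.sum_add_distrib (s := (Finset.univ : Finset (D.U × D.U)))).symm.trans ?_
    refine Finset.sum_eq_zero fun p _ => ?_
    have : joinClass n D p.1 p.2 + joinClass n (D.reattachT (D.ihxPermT v w)) p.1 p.2 +
        joinClass n (D.reattachT (D.ihxPermT v w)⁻¹) p.1 p.2 = 0 := by
      obtain ⟨a, b⟩ := p
      by_cases h : a = b
      · subst h
        exact (congrArg₂ (· + ·) (congrArg₂ (· + ·) (joinClass_self D a)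
          (joinClass_self (D.reattachT (D.ihxPermT v w)) a))
          (joinClass_self (D.reattachT (D.ihxPermT v w)⁻¹) a)).trans (by simp)
      · exact (congrArg₂ (· + ·) (congrArg₂ (· + ·) (joinClass_of_ne D a b h)
          (joinClass_reattachT D _ a b h)) (joinClass_reattachT D _ a b h)).trans
          (graphClass_ihx (D.join a b h) v w hvw (D.join_glue_inl _ _ h _ _ he))
    change ite (D.label p.1 = i ∧ D.label p.2 = j) _ _ +
      ite (D.label p.1 = i ∧ D.label p.2 = j) _ _ +
      ite (D.label p.1 = i ∧ D.label p.2 = j) _ _ = _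
    split_ifs
    · exact this
    · simp
  · refine (congrArg (_ + ·) Finset.smul_sum).trans ?_
    refine (Finset.sum_add_distrib (s := (Finset.univ : Finset (D.U × D.U)))).symm.trans ?_
    refine Finset.sum_eq_zero fun p _ => ?_
    have : joinClass n D.addCircle p.1 p.2 + (2 * (n : ℂ)) • joinClass n D p.1 p.2 = 0 := by
      obtain ⟨a, b⟩ := p
      by_cases h : a = b
      · subst h
        exact (congrArg₂ (fun x y => x + (2 * (n : ℂ)) • y) (joinClass_self D.addCircle a)
          (joinClass_self D a)).trans (by simp)
      · exact (congrArg₂ (fun x y => x + (2 * (n : ℂ)) • y) (joinClass_addCircle D a b h)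
          (joinClass_of_ne D a b h)).trans (graphClass_circle (D.join a b h))
    change ite (D.label p.1 = i ∧ D.label p.2 = j) _ _ +
      (2 * (n : ℂ)) • ite (D.label p.1 = i ∧ D.label p.2 = j) _ _ = _
    split_ifs
    · exact this
    · simp

/-- The operator of disjoint union with an edge marked `i` and `j`. -/
noncomputable def opL (n : ℕ) (i j : Fin g) : Module.End ℂ (GraphSpaceO g n) :=
  (addChord_isGraphInvariant n i j).lift

/-- The operator which replaces markings `i` by `j`, one at a time. -/
noncomputable def opH (n : ℕ) (i j : Fin g) : Module.End ℂ (GraphSpaceO g n) :=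
  (relabelSum_isGraphInvariant n i j).lift

/-- The operator which joins ends marked `i` and `j`. -/
noncomputable def opΛ (n : ℕ) (i j : Fin g) : Module.End ℂ (GraphSpaceO g n) :=
  (-1 / 4 : ℂ) • (joinSum_isGraphInvariant n i j).lift

theorem opL_graphClass (i j : Fin g) (D : MarkedGraph g) :
    opL n i j (graphClass n D) = graphClass n (D.addChord i j) :=
  (addChord_isGraphInvariant n i j).lift_graphClass D

open Classical in
theorem opH_graphClass (i j : Fin g) (D : MarkedGraph g) :
    opH n i j (graphClass n D) =
      ∑ u : D.U, if D.label u = i then graphClass n (D.relabel u j) else 0 :=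
  (relabelSum_isGraphInvariant n i j).lift_graphClass D

theorem opΛ_graphClass (i j : Fin g) (D : MarkedGraph g) :
    opΛ n i j (graphClass n D) = (-1 / 4 : ℂ) • joinSum n i j D := by
  rw [opΛ, LinearMap.smul_apply, IsGraphInvariant.lift_graphClass]

open Classical in
theorem joinSum_eq (i j : Fin g) (D : MarkedGraph g) :
    joinSum n i j D = ∑ a : D.U, ∑ b : D.U,
      if hab : a ≠ b ∧ D.label a = i ∧ D.label b = j then
        graphClass n (D.join a b hab.1) else 0 := by
  rw [joinSum, Fintype.sum_prod_type]
  refine Finset.sum_congr rfl fun a _ => Finset.sum_congr rfl fun b _ => ?_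
  unfold joinClass
  split_ifs <;> first | rfl | tauto

end operators

/-! ### Graph isomorphisms behind the commutation relations: chords and joins. -/

namespace MarkedGraph

/-- Criterion for a graph to be isomorphic to the one obtained by joining two edges. -/
theorem iso_join {D E : MarkedGraph g} {a b : D.U} (hab : a ≠ b) (eV : E.V ≃ D.V) (e : E.U → D.U)
    (he : Function.Injective e) (hr : ∀ u, (∃ w, e w = u) ↔ u ≠ a ∧ u ≠ b)
    (hglue : ∀ x, Sum.map (Prod.map eV id) e (E.glue x) =
      D.reroute a b (Sum.map (Prod.map eV id) e x))
    (hl : ∀ u, D.label (e u) = E.label u) (hc : (D.join a b hab).circles = E.circles) :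
    E.Iso (D.join a b hab) := by
  let eU : E.U ≃ {u : D.U // u ≠ a ∧ u ≠ b} :=
    Equiv.ofBijective (fun w => ⟨e w, (hr _).1 ⟨w, rfl⟩⟩) (by
      constructor
      · intro x y h
        exact he (Subtype.ext_iff.1 h)
      · rintro ⟨u, hu⟩
        obtain ⟨w, rfl⟩ := (hr u).2 hu
        exact ⟨w, rfl⟩)
  have h1 : ∀ x, D.incl a b (Sum.map (Prod.map eV id) eU x) = Sum.map (Prod.map eV id) e x := by
    rintro (x | x) <;> rfl
  refine Iso.of_equiv eV eU (fun x => D.incl_injective a b ?_) hl hc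
  refine (h1 _).trans ((hglue x).trans ?_)
  refine Eq.trans ?_ (D.incl_restrict a b _ _).symm
  exact congrArg (D.reroute a b) (h1 x).symm

theorem reroute_comm (D : MarkedGraph g) {a b : D.U} (hab : a ≠ b) (x : HalfEdge D.V D.U) :
    D.reroute b a x = D.reroute a b x := by
  have : (Sum.inr a : HalfEdge D.V D.U) ≠ Sum.inr b := fun h => hab (Sum.inr_injective h)
  unfold reroute
  split_ifs <;> grind

theorem reroute_left (D : MarkedGraph g) {a b : D.U} {x : HalfEdge D.V D.U}
    (h : D.glue x = Sum.inr a) : D.reroute a b x = D.glue (Sum.inr b) := if_pos h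

theorem reroute_right (D : MarkedGraph g) {a b : D.U} {x : HalfEdge D.V D.U}
    (h' : D.glue x ≠ Sum.inr a) (h : D.glue x = Sum.inr b) :
    D.reroute a b x = D.glue (Sum.inr a) := (if_neg h').trans (if_pos h)

theorem reroute_of_ne (D : MarkedGraph g) {a b : D.U} {x : HalfEdge D.V D.U}
    (h : D.glue x ≠ Sum.inr a) (h' : D.glue x ≠ Sum.inr b) :
    D.reroute a b x = D.glue x := (if_neg h).trans (if_neg h')

/-- Rerouting is symmetric in the two ends, and so is the condition that they belong to one edge. -/
theorem join_comm (D : MarkedGraph g) {a b : D.U} (hab : a ≠ b) :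
    (D.join b a hab.symm).Iso (D.join a b hab) := by
  classical
  refine iso_join hab (Equiv.refl D.V) Subtype.val Subtype.val_injective ?_ ?_ (fun _ => rfl) ?_
  · intro u
    constructor
    · rintro ⟨⟨w, hw⟩, rfl⟩
      exact hw.symm
    · exact fun h => ⟨⟨u, h.symm⟩, rfl⟩
  · intro x
    exact (D.incl_restrict b a _ _).trans (D.reroute_comm hab _)
  · have : D.glue (Sum.inr a) = Sum.inr b ↔ D.glue (Sum.inr b) = Sum.inr a := by
      rw [glue_eq_iff, eq_comm]
    simp only [join, this]

/-- A univalent vertex of a graph as a vertex of its disjoint union with an edge. -/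
def chordOld (D : MarkedGraph g) (k l : Fin g) (u : D.U) : (D.addChord k l).U := Sum.inl u

/-- The ends of the additional edge. -/
def chordNew (D : MarkedGraph g) (k l : Fin g) (t : Fin 2) : (D.addChord k l).U := Sum.inr t

theorem chord_cases (D : MarkedGraph g) {k l : Fin g} (u : (D.addChord k l).U) :
    (∃ w, u = D.chordOld k l w) ∨ ∃ t, u = D.chordNew k l t := by
  rcases u with w | t
  · exact Or.inl ⟨w, rfl⟩
  · exact Or.inr ⟨t, rfl⟩

theorem chordOld_injective (D : MarkedGraph g) (k l : Fin g) :
    Function.Injective (D.chordOld k l) := Sum.inl_injective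

theorem chordNew_injective (D : MarkedGraph g) (k l : Fin g) :
    Function.Injective (D.chordNew k l) := Sum.inr_injective

theorem chordOld_ne_chordNew (D : MarkedGraph g) (k l : Fin g) (u : D.U) (t : Fin 2) :
    D.chordOld k l u ≠ D.chordNew k l t := Sum.inl_ne_inr

theorem chordIncl_injective (D : MarkedGraph g) (k l : Fin g) :
    Function.Injective (D.chordIncl k l) :=
  Function.injective_id.sumMap Sum.inl_injective

theorem chordIncl_inr (D : MarkedGraph g) (k l : Fin g) (u : D.U) :
    D.chordIncl k l (Sum.inr u) = Sum.inr (D.chordOld k l u) := rfl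

theorem chordIncl_ne (D : MarkedGraph g) (k l : Fin g) (x : HalfEdge D.V D.U) (t : Fin 2) :
    D.chordIncl k l x ≠ Sum.inr (D.chordNew k l t) := by
  rcases x with x | x <;> intro h <;> cases h

theorem addChord_glue_chordOld (D : MarkedGraph g) (k l : Fin g) (u : D.U) :
    (D.addChord k l).glue (Sum.inr (D.chordOld k l u)) =
      D.chordIncl k l (D.glue (Sum.inr u)) := rfl

theorem addChord_glue_chordNew (D : MarkedGraph g) (k l : Fin g) (t : Fin 2) :
    (D.addChord k l).glue (Sum.inr (D.chordNew k l t)) =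
      Sum.inr (D.chordNew k l (1 - t)) := rfl

theorem addChord_reroute_chordOld (D : MarkedGraph g) (k l : Fin g) {a b : D.U}
    (x : HalfEdge D.V D.U) :
    (D.addChord k l).reroute (D.chordOld k l a) (D.chordOld k l b) (D.chordIncl k l x) =
      D.chordIncl k l (D.reroute a b x) := by
  classical
  simp only [reroute, ← chordIncl_inr, addChord_glue, (D.chordIncl_injective k l).eq_iff]
  split_ifs <;> rfl

/-- The chord is a separate component, so it is unaffected by a join of two old ends. -/
theorem addChord_join_chordOld (D : MarkedGraph g) (k l : Fin g) {a b : D.U} (hab : a ≠ b) :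
    ((D.join a b hab).addChord k l).Iso ((D.addChord k l).join (D.chordOld k l a)
      (D.chordOld k l b) ((D.chordOld_injective k l).ne hab)) := by
  classical
  let e : ((D.join a b hab).addChord k l).U → (D.addChord k l).U := Sum.map Subtype.val id
  let φ : HalfEdge ((D.join a b hab).addChord k l).V ((D.join a b hab).addChord k l).U →
    HalfEdge (D.addChord k l).V (D.addChord k l).U := Sum.map (Prod.map (Equiv.refl D.V) id) e
  have main : ∀ x, φ (((D.join a b hab).addChord k l).glue ((D.join a b hab).chordIncl k l x)) =
      (D.addChord k l).reroute (D.chordOld k l a) (D.chordOld k l b)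
        (φ ((D.join a b hab).chordIncl k l x)) := by
    intro x
    have h1 : ∀ x, φ ((D.join a b hab).chordIncl k l x) = D.chordIncl k l (D.incl a b x) := by
      rintro (x | x) <;> rfl
    rw [addChord_glue, h1, h1, addChord_reroute_chordOld]
    exact congrArg _ (D.incl_restrict a b _ _)
  refine iso_join (D := D.addChord k l) ((D.chordOld_injective k l).ne hab) (Equiv.refl D.V) e
    (Subtype.val_injective.sumMap Function.injective_id) ?_ ?_ ?_ ?_
  · intro u
    rcases D.chord_cases u with ⟨u, rfl⟩ | ⟨t, rfl⟩
    · rw [(D.chordOld_injective k l).ne_iff, (D.chordOld_injective k l).ne_iff]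
      constructor
      · rintro ⟨⟨w, hw⟩ | w, h⟩
        · cases h
          exact hw
        · cases h
      · exact fun h => ⟨Sum.inl ⟨u, h⟩, rfl⟩
    · exact ⟨fun _ => ⟨(D.chordOld_ne_chordNew k l a t).symm,
        (D.chordOld_ne_chordNew k l b t).symm⟩, fun _ => ⟨Sum.inr t, rfl⟩⟩
  · rintro (x | x | x)
    · exact main (Sum.inl x)
    · exact main (Sum.inr x)
    · have h := D.addChord_glue_chordNew k l x
      exact ((D.addChord k l).reroute_of_ne
        (fun h' => D.chordIncl_ne k l (Sum.inr a) _ (h'.symm.trans h))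
        (fun h' => D.chordIncl_ne k l (Sum.inr b) _ (h'.symm.trans h))).symm
  · rintro (u | u) <;> rfl
  · have h : (D.addChord k l).glue (Sum.inr (D.chordOld k l a)) = Sum.inr (D.chordOld k l b) ↔
        D.glue (Sum.inr a) = Sum.inr b := by
      rw [addChord_glue_chordOld, ← chordIncl_inr, (D.chordIncl_injective k l).eq_iff]
    exact congrArg (D.circles + ·) (if_congr h rfl rfl)

/-- Joining an old end to one end of the chord only lengthens the old edge: it now stops at the
other end of the chord, whose marking it inherits. -/
theorem addChord_join_chordNew (D : MarkedGraph g) (k l : Fin g) (a : D.U) (t : Fin 2) :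
    (D.relabel a (![k, l] (1 - t))).Iso ((D.addChord k l).join (D.chordOld k l a)
      (D.chordNew k l t) (D.chordOld_ne_chordNew k l a t)) := by
  classical
  have h01 : (1 - t : Fin 2) ≠ t := by fin_cases t <;> simp
  have h10 : (1 - (1 - t) : Fin 2) = t := by simp
  have h2 : ∀ s : Fin 2, s ≠ t → s = 1 - t := by fin_cases t <;> decide
  -- The free end of the chord takes the place of `a`; all other ends stay where they were.
  let e : D.U → (D.addChord k l).U :=
    fun u => if u = a then D.chordNew k l (1 - t) else D.chordOld k l u
  have hea : e a = D.chordNew k l (1 - t) := if_pos rfl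
  have he : ∀ u, u ≠ a → e u = D.chordOld k l u := fun u h => if_neg h
  have heinj : Function.Injective e := by
    intro x y h
    simp only [e] at h
    split_ifs at h with h1 h2
    · exact h1.trans h2.symm
    · exact absurd h.symm (D.chordOld_ne_chordNew k l _ _)
    · exact absurd h (D.chordOld_ne_chordNew k l _ _)
    · exact D.chordOld_injective k l h
  let φ : HalfEdge D.V D.U → HalfEdge (D.addChord k l).V (D.addChord k l).U :=
    Sum.map (Prod.map (Equiv.refl D.V) id) e
  have hφa : φ (Sum.inr a) = Sum.inr (D.chordNew k l (1 - t)) := congrArg Sum.inr hea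
  have hφ : ∀ x, x ≠ Sum.inr a → φ x = D.chordIncl k l x := by
    rintro (x | x) h
    · rfl
    · exact congrArg Sum.inr (he x fun h' => h (congrArg _ h'))
  have hglue : ∀ x : HalfEdge D.V D.U, φ (D.glue x) =
      (D.addChord k l).reroute (D.chordOld k l a) (D.chordNew k l t) (φ x) := by
    intro x
    by_cases hx : x = Sum.inr a
    · subst hx
      have h3 : (D.addChord k l).glue (φ (Sum.inr a)) = Sum.inr (D.chordNew k l t) := by
        rw [hφa, addChord_glue_chordNew, h10]
      rw [hφ _ (D.glue_ne _), reroute_right _ _ h3, addChord_glue_chordOld]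
      rw [h3]
      exact (D.chordIncl_ne k l (Sum.inr a) t).symm
    · have h3 : (D.addChord k l).glue (φ x) = D.chordIncl k l (D.glue x) := by
        rw [hφ x hx, addChord_glue]
      by_cases hx' : D.glue x = Sum.inr a
      · rw [reroute_left _ (by rw [h3, hx']; rfl), addChord_glue_chordNew, hx', hφa]
      · rw [reroute_of_ne _ _ _, hφ _ hx', h3]
        · rw [h3, ← chordIncl_inr]
          exact (D.chordIncl_injective k l).ne hx'
        · rw [h3]
          exact D.chordIncl_ne k l _ _
  have hlab : ∀ u : D.U, (D.addChord k l).label (e u) =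
      Function.update D.label a (![k, l] (1 - t)) u := by
    intro u
    simp only [e, Function.update_apply]
    split_ifs <;> rfl
  refine iso_join (D := D.addChord k l) (D.chordOld_ne_chordNew k l a t) (Equiv.refl D.V) e heinj
    ?_ hglue hlab ((congrArg (D.circles + ·) (if_neg (D.chordIncl_ne k l _ _))).trans (add_zero _))
  intro u
  rcases D.chord_cases u with ⟨u, rfl⟩ | ⟨s, rfl⟩
  · rw [(D.chordOld_injective k l).ne_iff]
    constructor
    · rintro ⟨w, h⟩
      simp only [e] at h
      split_ifs at h with h'
      · exact absurd h.symm (D.chordOld_ne_chordNew k l _ _)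
      · rw [← D.chordOld_injective k l h]
        exact ⟨h', D.chordOld_ne_chordNew k l _ _⟩
    · exact fun h => ⟨u, he u h.1⟩
  · rw [(D.chordNew_injective k l).ne_iff]
    constructor
    · rintro ⟨w, h⟩
      simp only [e] at h
      split_ifs at h with h'
      · rw [← D.chordNew_injective k l h]
        exact ⟨(D.chordOld_ne_chordNew k l _ _).symm, h01⟩
      · exact absurd h (D.chordOld_ne_chordNew k l _ _)
    · rintro ⟨-, h⟩
      exact ⟨a, by rw [hea, h2 s h]⟩

/-- The chord closes up on itself. This is the only source of circles involving the new edge, hence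
of the scalar term in `lie_opΛ_opL`. -/
theorem addChord_join_chordNew_chordNew (D : MarkedGraph g) (k l : Fin g) {s t : Fin 2}
    (hst : s ≠ t) :
    D.addCircle.Iso ((D.addChord k l).join (D.chordNew k l s) (D.chordNew k l t)
      ((D.chordNew_injective k l).ne hst)) := by
  classical
  have h1 : (1 - s : Fin 2) = t := by revert s t; decide
  have h2 : ∀ u : Fin 2, u = s ∨ u = t := by revert s t; decide
  refine iso_join (D := D.addChord k l) (E := D.addCircle) ((D.chordNew_injective k l).ne hst)
    (Equiv.refl D.V) (D.chordOld k l) (D.chordOld_injective k l) ?_ ?_ (fun _ => rfl) ?_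
  · intro u
    rcases D.chord_cases u with ⟨u, rfl⟩ | ⟨r, rfl⟩
    · exact ⟨fun _ => ⟨D.chordOld_ne_chordNew k l _ _, D.chordOld_ne_chordNew k l _ _⟩,
        fun _ => ⟨u, rfl⟩⟩
    · constructor
      · rintro ⟨w, h⟩
        exact absurd h (D.chordOld_ne_chordNew k l _ _)
      · rintro ⟨h, h'⟩
        rcases h2 r with rfl | rfl
        · exact absurd rfl h
        · exact absurd rfl h'
  · intro x
    change D.chordIncl k l (D.glue x) = (D.addChord k l).reroute _ _ (D.chordIncl k l x)
    have h3 := D.addChord_glue k l x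
    exact (((D.addChord k l).reroute_of_ne (fun h => D.chordIncl_ne k l _ _ (h3.symm.trans h))
      (fun h => D.chordIncl_ne k l _ _ (h3.symm.trans h))).trans h3).symm
  · refine congrArg (D.circles + ·) (if_pos ?_)
    rw [addChord_glue_chordNew, h1]

theorem addChord_swap (D : MarkedGraph g) (i j : Fin g) :
    (D.addChord i j).Iso (D.addChord j i) := by
  refine Iso.of_equiv (E := D.addChord j i) (Equiv.refl D.V)
    (Equiv.sumCongr (Equiv.refl D.U) (Equiv.swap 0 1)) ?_ ?_ rfl
  · have : ∀ x, Sum.map (Prod.map (Equiv.refl D.V) id)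
        (Equiv.sumCongr (Equiv.refl D.U) (Equiv.swap (0 : Fin 2) 1)) (D.chordIncl i j x) =
        D.chordIncl j i x := by rintro (x | x) <;> rfl
    rintro (x | x | x)
    · exact this _
    · exact this _
    · fin_cases x <;> rfl
  · rintro (u | u)
    · rfl
    · fin_cases u <;> rfl

theorem addChord_addChord (D : MarkedGraph g) (i j k l : Fin g) :
    ((D.addChord i j).addChord k l).Iso ((D.addChord k l).addChord i j) := by
  let e : (D.U ⊕ Fin 2) ⊕ Fin 2 ≃ (D.U ⊕ Fin 2) ⊕ Fin 2 :=
    (Equiv.sumAssoc _ _ _).trans (((Equiv.refl _).sumCongr (Equiv.sumComm _ _)).trans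
      (Equiv.sumAssoc _ _ _).symm)
  refine Iso.of_equiv (D := (D.addChord i j).addChord k l) (E := (D.addChord k l).addChord i j)
    (Equiv.refl D.V) e ?_ ?_ rfl
  · have : ∀ x, Sum.map (Prod.map (Equiv.refl D.V) id) e
        ((D.addChord i j).chordIncl k l (D.chordIncl i j x)) =
        (D.addChord k l).chordIncl i j (D.chordIncl k l x) := by rintro (x | x) <;> rfl
    have h2 : ∀ x, ((D.addChord i j).addChord k l).glue
        ((D.addChord i j).chordIncl k l (D.chordIncl i j x)) =
        (D.addChord i j).chordIncl k l (D.chordIncl i j (D.glue x)) := by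
      intro x; rw [addChord_glue, addChord_glue]
    have h3 : ∀ x, ((D.addChord k l).addChord i j).glue
        ((D.addChord k l).chordIncl i j (D.chordIncl k l x)) =
        (D.addChord k l).chordIncl i j (D.chordIncl k l (D.glue x)) := by
      intro x; rw [addChord_glue, addChord_glue]
    have h4 := fun x => (congrArg _ (h2 x)).trans ((this _).trans
      ((h3 x).symm.trans (congrArg _ (this x).symm)))
    rintro (x | (x | x) | x)
    · exact h4 (Sum.inl x)
    · exact h4 (Sum.inr x)
    · rfl
    · rfl
  · rintro ((u | u) | u) <;> rfl

/-- This is the combinatorial core of the commutation of two joins, stated for a fixed-point-free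
involution on a bare set so that no subtypes of ends occur. Outside the four ends, the result is
determined by the case distinction on which of them are matched by `s`. -/
theorem reroute_join_reroute {H : Type*} (s : H → H) (hs : ∀ x, s (s x) = x) {a b c d : H}
    (hac : a ≠ c) (had : a ≠ d) (hbc : b ≠ c) (hbd : b ≠ d) (R S : H → H)
    (hab : a ≠ b) (hcd : c ≠ d) (h0 : ∀ x, s x ≠ x) [DecidableEq H]
    (hR : ∀ x, R x = if s x = a then s b else if s x = b then s a else s x)
    (hS : ∀ x, S x = if s x = c then s d else if s x = d then s c else s x)
    (x : H) (xa : x ≠ a) (xb : x ≠ b) (xc : x ≠ c) (xd : x ≠ d) :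
    (if R x = c then R d else if R x = d then R c else R x) =
      (if S x = a then S b else if S x = b then S a else S x) := by
  -- Moving `s` across an equation is the fact needed to eliminate the inconsistent cases.
  have e : ∀ y z, s y = z → y = s z := fun y z h => by rw [← h, hs]
  have ha := h0 a
  have hb := h0 b
  have hc := h0 c
  have hd := h0 d
  simp only [hR, hS]
  grind

/-- Only the total over both joins is independent of their order in an obvious way. For instance, if
`s a = c` and `s b = d`, the first join creates no circle and the second creates one, in either
order; if `s a = b`, that circle appears at the `a`, `b` join whenever it is performed. -/
theorem circles_join_join {H : Type*} (s : H → H) (hs : ∀ x, s (s x) = x) {a b c d : H}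
    (hac : a ≠ c) (had : a ≠ d) (hbc : b ≠ c) (hbd : b ≠ d) (R S : H → H)
    (hab : a ≠ b) (hcd : c ≠ d) [DecidableEq H]
    (hR : ∀ x, R x = if s x = a then s b else if s x = b then s a else s x)
    (hS : ∀ x, S x = if s x = c then s d else if s x = d then s c else s x) :
    ((if s a = b then 1 else 0) + if R c = d then 1 else 0) =
      (if s c = d then 1 else 0) + if S a = b then 1 else 0 := by
  have ha := hs a
  have hb := hs b
  have hc := hs c
  have hd := hs d
  simp only [hR, hS]
  split_ifs <;> grind

/-- Expresses the edges of a double join inside the half-edges of `D`, so that two double joins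
taken in different orders can be compared there. -/
theorem incl_reroute_join (D : MarkedGraph g) {a b : D.U} (hab : a ≠ b)
    (c d : (D.join a b hab).U) (x : HalfEdge (D.join a b hab).V (D.join a b hab).U) :
    open Classical in
    D.incl a b ((D.join a b hab).reroute c d x) =
      if D.reroute a b (D.incl a b x) = Sum.inr c.1 then D.reroute a b (Sum.inr d.1)
      else if D.reroute a b (D.incl a b x) = Sum.inr d.1 then D.reroute a b (Sum.inr c.1)
      else D.reroute a b (D.incl a b x) := by
  classical
  let ι : HalfEdge (D.join a b hab).V (D.join a b hab).U → HalfEdge D.V D.U := D.incl a b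
  have h1 : ∀ x, ι ((D.join a b hab).glue x) = D.reroute a b (ι x) :=
    fun x => D.incl_restrict a b _ _
  have h2 : ∀ (x : HalfEdge (D.join a b hab).V (D.join a b hab).U) (u : (D.join a b hab).U),
      (D.join a b hab).glue x = Sum.inr u ↔ D.reroute a b (ι x) = Sum.inr u.1 := by
    intro x u
    rw [← h1]
    exact (D.incl_injective a b).eq_iff.symm
  have h3 : (D.join a b hab).reroute c d x =
      if (D.join a b hab).glue x = Sum.inr c then (D.join a b hab).glue (Sum.inr d)
      else if (D.join a b hab).glue x = Sum.inr d then (D.join a b hab).glue (Sum.inr c)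
      else (D.join a b hab).glue x := rfl
  change ι _ = _
  rw [h3, apply_ite ι, apply_ite ι, h1, h1, h1]
  simp only [h2]
  rfl

theorem join_join (D : MarkedGraph g) {a b c d : D.U} (hab : a ≠ b) (hcd : c ≠ d)
    (hc : c ≠ a ∧ c ≠ b) (hd : d ≠ a ∧ d ≠ b) (ha : a ≠ c ∧ a ≠ d) (hb : b ≠ c ∧ b ≠ d) :
    ((D.join a b hab).join ⟨c, hc⟩ ⟨d, hd⟩ (fun h => hcd (congrArg Subtype.val h))).Iso
      ((D.join c d hcd).join ⟨a, ha⟩ ⟨b, hb⟩ (fun h => hab (congrArg Subtype.val h))) := by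
  classical
  have hr : ∀ {u v : D.U}, u ≠ v → (Sum.inr u : HalfEdge D.V D.U) ≠ Sum.inr v :=
    fun h => Sum.inr_injective.ne h
  let E := (D.join a b hab).join ⟨c, hc⟩ ⟨d, hd⟩ (fun h => hcd (congrArg Subtype.val h))
  let F := D.join c d hcd
  let e : E.U → F.U := fun u => ⟨u.1.1, fun h => u.2.1 (Subtype.ext h),
    fun h => u.2.2 (Subtype.ext h)⟩
  let φ : HalfEdge E.V E.U → HalfEdge F.V F.U := Sum.map (Prod.map (Equiv.refl D.V) id) e
  let ι : HalfEdge E.V E.U → HalfEdge D.V D.U :=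
    fun x => D.incl a b ((D.join a b hab).incl ⟨c, hc⟩ ⟨d, hd⟩ x)
  have hφ : ∀ x, D.incl c d (φ x) = ι x := by rintro (x | x) <;> rfl
  refine iso_join (D := F) (E := E) (a := ⟨a, ha⟩) (b := ⟨b, hb⟩) _ (Equiv.refl D.V) e ?_ ?_ ?_
    (fun _ => rfl) ?_
  · intro u v h
    exact Subtype.ext (Subtype.ext
      (congrArg (fun w : {u : D.U // u ≠ c ∧ u ≠ d} => w.1) h))
  · intro u
    constructor
    · rintro ⟨w, rfl⟩
      exact ⟨fun h => w.1.2.1 (congrArg Subtype.val h), fun h => w.1.2.2 (congrArg Subtype.val h)⟩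
    · rintro ⟨h1, h2⟩
      exact ⟨⟨⟨u.1, fun h => h1 (Subtype.ext h), fun h => h2 (Subtype.ext h)⟩,
        fun h => u.2.1 (congrArg Subtype.val h), fun h => u.2.2 (congrArg Subtype.val h)⟩, rfl⟩
  · intro x
    apply D.incl_injective c d
    refine (hφ _).trans ?_
    refine Eq.trans ?_ (D.incl_reroute_join hcd ⟨a, ha⟩ ⟨b, hb⟩ (φ x)).symm
    rw [hφ]
    refine (congrArg (D.incl a b) ((D.join a b hab).incl_restrict _ _ _ _)).trans ?_
    refine (D.incl_reroute_join hab ⟨c, hc⟩ ⟨d, hd⟩ _).trans ?_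
    have h1 := D.incl_ne a b ((D.join a b hab).incl ⟨c, hc⟩ ⟨d, hd⟩ x)
    have h2 := D.incl_ne c d (φ x)
    rw [hφ] at h2
    exact reroute_join_reroute D.glue D.glue_glue (hr ha.1) (hr ha.2) (hr hb.1) (hr hb.2)
      (D.reroute a b) (D.reroute c d) (hr hab) (hr hcd) D.glue_ne (fun _ => rfl) (fun _ => rfl)
      _ h1.1 h1.2 h2.1 h2.2
  · have h := circles_join_join D.glue D.glue_glue (hr ha.1) (hr ha.2) (hr hb.1) (hr hb.2)
      (D.reroute a b) (D.reroute c d) (hr hab) (hr hcd) (fun _ => rfl) (fun _ => rfl)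
    -- Whether the second join closes a circle is read off in `D` from the edges already rerouted by
    -- the first.
    have h3 : ∀ {a b c d : D.U} (hab : a ≠ b) (hc : c ≠ a ∧ c ≠ b) (hd : d ≠ a ∧ d ≠ b),
        (D.join a b hab).glue (Sum.inr ⟨c, hc⟩) = Sum.inr ⟨d, hd⟩ ↔
          D.reroute a b (Sum.inr c) = Sum.inr d := by
      intro a b c d hab hc hd
      exact (D.incl_injective a b).eq_iff.symm.trans <| Iff.of_eq (congrArg (· = _) (D.incl_restrict a b _ _))
    have h4 : ∀ {a b c d : D.U} (hab : a ≠ b) (hcd : c ≠ d) (hc : c ≠ a ∧ c ≠ b)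
        (hd : d ≠ a ∧ d ≠ b), ((D.join a b hab).join ⟨c, hc⟩ ⟨d, hd⟩
          (fun h => hcd (congrArg Subtype.val h))).circles = D.circles +
          ((if D.glue (Sum.inr a) = Sum.inr b then 1 else 0) +
            if D.reroute a b (Sum.inr c) = Sum.inr d then 1 else 0) := by
      intro a b c d hab hcd hc hd
      rw [← add_assoc]
      exact congrArg (D.circles + ite (D.glue (Sum.inr a) = Sum.inr b) 1 0 + ·)
        (if_congr (h3 hab hc hd) rfl rfl)
    refine (h4 hcd hab ha hb).trans ((congrArg (D.circles + ·) h.symm).trans ?_)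
    exact (h4 hab hcd hc hd).symm

end MarkedGraph

/-! ### Graph isomorphisms behind the commutation relations: relabelling. -/

namespace MarkedGraph

theorem relabel_addChord (D : MarkedGraph g) (i j : Fin g) (u : D.U) (l : Fin g) :
    ((D.relabel u l).addChord i j).Iso ((D.addChord i j).relabel (D.chordOld i j u) l) := by
  classical
  refine Iso.of_eq ?_ ?_ rfl
  · funext x
    rcases x with x | x | x <;> rfl
  · have : ∀ w : D.U ⊕ Fin 2, Sum.elim (Function.update D.label u l) ![i, j] w =
        Function.update (Sum.elim D.label ![i, j]) (Sum.inl u) l w := by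
      rintro (w | w)
      · simp [Function.update_apply]
      · simp
    funext w
    exact (this w).trans (by congr)

theorem addChord_relabel_chordNew_zero (D : MarkedGraph g) (i j l : Fin g) :
    ((D.addChord i j).relabel (D.chordNew i j 0) l).Iso (D.addChord l j) := by
  classical
  refine Iso.of_eq rfl ?_ rfl
  have : ∀ w : D.U ⊕ Fin 2, Function.update (Sum.elim D.label ![i, j]) (Sum.inr 0) l w =
      Sum.elim D.label ![l, j] w := by
    rintro (w | w)
    · simp
    · fin_cases w <;> simp
  funext w
  exact Eq.trans (by congr) (this w)

theorem addChord_relabel_chordNew_one (D : MarkedGraph g) (i j l : Fin g) :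
    ((D.addChord i j).relabel (D.chordNew i j 1) l).Iso (D.addChord i l) := by
  classical
  refine Iso.of_eq rfl ?_ rfl
  have : ∀ w : D.U ⊕ Fin 2, Function.update (Sum.elim D.label ![i, j]) (Sum.inr 1) l w =
      Sum.elim D.label ![i, l] w := by
    rintro (w | w)
    · simp
    · fin_cases w <;> simp
  funext w
  exact Eq.trans (by congr) (this w)

theorem relabel_join (D : MarkedGraph g) {a b : D.U} (hab : a ≠ b) (u : (D.join a b hab).U)
    (l : Fin g) : ((D.join a b hab).relabel u l).Iso ((D.relabel u.1 l).join a b hab) := by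
  classical
  refine Iso.of_eq ?_ ?_ rfl
  · funext x
    apply D.incl_injective a b
    exact (D.incl_restrict a b _ _).trans ((D.relabel u.1 l).incl_restrict a b _ _).symm
  · have : ∀ (inst : DecidableEq {u : D.U // u ≠ a ∧ u ≠ b}) (w : {u : D.U // u ≠ a ∧ u ≠ b}),
        Function.update (α := {u : D.U // u ≠ a ∧ u ≠ b}) (fun w => D.label w.1) u l w =
          Function.update D.label u.1 l w.1 := by
      intro _ w
      by_cases h : w = u
      · subst h
        exact (Function.update_self _ _ _).trans (Function.update_self w.1 l D.label).symm
      · exact (Function.update_of_ne h l (fun w => D.label w.1)).trans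
          (Function.update_of_ne (fun h' : w.1 = u.1 => h (Subtype.ext h')) l D.label).symm
    funext w
    exact Eq.trans (this _ w) (by congr)

/-- The marking of an end that is about to be removed leaves no trace. -/
theorem relabel_join_of_mem (D : MarkedGraph g) {a b : D.U} (hab : a ≠ b) (u : D.U)
    (hu : u = a ∨ u = b) (l : Fin g) :
    ((D.relabel u l).join a b hab).Iso (D.join a b hab) := by
  classical
  refine Iso.of_eq ?_ ?_ rfl
  · funext x
    apply D.incl_injective a b
    exact ((D.relabel u l).incl_restrict a b _ _).trans (D.incl_restrict a b _ _).symm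
  · have : ∀ w : {u : D.U // u ≠ a ∧ u ≠ b}, Function.update D.label u l w.1 = D.label w.1 := by
      rintro ⟨w, hw⟩
      refine Function.update_of_ne ?_ _ _
      rintro rfl
      tauto
    funext w
    exact this w

theorem relabel_relabel_self (D : MarkedGraph g) (u : D.U) (j l : Fin g) :
    (D.relabel u l).relabel u j = D.relabel u j := by
  classical
  have := Function.update_idem l j D.label (a := u)
  unfold relabel
  congr 1

theorem relabel_relabel_comm (D : MarkedGraph g) {u w : D.U} (h : u ≠ w) (j l : Fin g) :
    (D.relabel u l).relabel w j = (D.relabel w j).relabel u l := by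
  classical
  have := Function.update_comm h.symm j l D.label
  unfold relabel
  congr 1
  exact this.symm

open Classical in
theorem relabel_label (D : MarkedGraph g) (u w : D.U) (l : Fin g) :
    (D.relabel u l).label w = if w = u then l else D.label w :=
  Function.update_apply D.label u l w

theorem sum_addChord_U {M : Type*} [AddCommMonoid M] (D : MarkedGraph g) (k l : Fin g)
    (f : (D.addChord k l).U → M) : ∑ u, f u =
      ∑ u, f (D.chordOld k l u) + (f (D.chordNew k l 0) + f (D.chordNew k l 1)) := by
  refine Eq.trans ?_ (congrArg _ (Fin.sum_univ_two fun t => f (D.chordNew k l t)))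
  exact Fintype.sum_sum_type (α₁ := D.U) (α₂ := Fin 2) f

end MarkedGraph

/-- The ends of a join form a subtype of the ends of the original graph. Extension by zero puts sums
before and after a join over the same index set. -/
theorem sum_subtype_eq_sum_dite {α M : Type*} [AddCommMonoid M] [Fintype α] {P : α → Prop}
    [DecidablePred P] [Fintype {u // P u}] (f : {u // P u} → M) :
    ∑ x, f x = ∑ u, if h : P u then f ⟨u, h⟩ else 0 := by
  let F : α → M := fun u => if h : P u then f ⟨u, h⟩ else 0
  have h1 : ∑ x, f x = ∑ x : {u // P u}, F x.1 :=
    Finset.sum_congr rfl fun x _ => (dif_pos x.2 : F x.1 = _).symm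
  rw [h1, ← Finset.sum_subtype (Finset.univ.filter P) (p := P) (by simp) F]
  refine Finset.sum_filter_of_ne fun u _ hu => ?_
  by_contra h
  exact hu (dif_neg h)

/-! ### The commutation relations. -/

section operators

variable {n : ℕ}

theorem joinClass_comm (D : MarkedGraph g) (a b : D.U) :
    joinClass n D a b = joinClass n D b a := by
  by_cases h : a = b
  · rw [h]
  · rw [joinClass_of_ne D a b h, joinClass_of_ne D b a (Ne.symm h), graphClass_iso (D.join_comm h)]

theorem opL_joinClass (k l : Fin g) (D : MarkedGraph g) (a b : D.U) :
    opL n k l (joinClass n D a b) =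
      joinClass n (D.addChord k l) (D.chordOld k l a) (D.chordOld k l b) := by
  by_cases h : a = b
  · rw [h, joinClass_self, joinClass_self, map_zero]
  · rw [joinClass_of_ne D a b h, joinClass_of_ne _ _ _ ((D.chordOld_injective k l).ne h),
      opL_graphClass, graphClass_iso (D.addChord_join_chordOld k l h)]

theorem joinClass_chordOld_chordNew (k l : Fin g) (D : MarkedGraph g) (a : D.U) (t : Fin 2) :
    joinClass n (D.addChord k l) (D.chordOld k l a) (D.chordNew k l t) =
      graphClass n (D.relabel a (![k, l] (1 - t))) := by
  rw [joinClass_of_ne _ _ _ (D.chordOld_ne_chordNew k l a t),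
    graphClass_iso (D.addChord_join_chordNew k l a t)]

theorem joinClass_chordNew_chordNew (k l : Fin g) (D : MarkedGraph g) {s t : Fin 2} (h : s ≠ t) :
    joinClass n (D.addChord k l) (D.chordNew k l s) (D.chordNew k l t) =
      -((2 * (n : ℂ)) • graphClass n D) := by
  rw [joinClass_of_ne _ _ _ ((D.chordNew_injective k l).ne h),
    ← graphClass_iso (D.addChord_join_chordNew_chordNew k l h), eq_neg_iff_add_eq_zero]
  exact graphClass_circle D

/-- Ordered pairs of ends of the enlarged graph split into nine blocks. Two old ends give the first
term; the four mixed blocks are relabellings to the marking of the opposite chord end; the blocks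
pairing different chord ends give one circle each; the two remaining blocks are diagonal and vanish.
-/
theorem joinSum_addChord (i j k l : Fin g) (D : MarkedGraph g) :
    joinSum n i j (D.addChord k l) = opL n k l (joinSum n i j D) +
      (kron i k • opH n j l (graphClass n D) + kron i l • opH n j k (graphClass n D) +
        kron j k • opH n i l (graphClass n D) + kron j l • opH n i k (graphClass n D)) -
      (kron i l * kron j k + kron i k * kron j l) • (2 * (n : ℂ)) • graphClass n D := by
  classical
  have hold : ∀ u, (D.addChord k l).label (D.chordOld k l u) = D.label u := fun _ => rfl
  have h0 : (D.addChord k l).label (D.chordNew k l 0) = k := rfl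
  have h1 : (D.addChord k l).label (D.chordNew k l 1) = l := rfl
  have e0 : (![k, l] (1 - 0) : Fin g) = l := rfl
  have e1 : (![k, l] (1 - 1) : Fin g) = k := rfl
  -- In a mixed block the condition on the chord end becomes a scalar Kronecker delta, while the
  -- condition on the old end stays in the sum and produces `opH`. The two versions serve the two
  -- orders of the pair.
  have hk : ∀ (P Q : Prop) [Decidable P] [Decidable Q] (x : GraphSpaceO g n),
      (if P ∧ Q then x else 0) = (if Q then (1 : ℂ) else 0) • if P then x else 0 := by
    intro P Q _ _ x
    by_cases hP : P <;> by_cases hQ : Q <;> simp [hP, hQ]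
  have hk' : ∀ (P Q : Prop) [Decidable P] [Decidable Q] (x : GraphSpaceO g n),
      (if P ∧ Q then x else 0) = (if P then (1 : ℂ) else 0) • if Q then x else 0 := by
    intro P Q _ _ x
    by_cases hP : P <;> by_cases hQ : Q <;> simp [hP, hQ]
  have hL : opL n k l (joinSum n i j D) = ∑ a, ∑ b, if D.label a = i ∧ D.label b = j then
      joinClass n (D.addChord k l) (D.chordOld k l a) (D.chordOld k l b) else 0 := by
    rw [joinSum, Fintype.sum_prod_type]
    simp only [map_sum, apply_ite (opL n k l), map_zero, opL_joinClass]
  have hc : ∀ a t, joinClass n (D.addChord k l) (D.chordNew k l t) (D.chordOld k l a) =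
      graphClass n (D.relabel a (![k, l] (1 - t))) := fun a t => by
    rw [joinClass_comm, joinClass_chordOld_chordNew]
  rw [joinSum, Fintype.sum_prod_type, sum_addChord_U]
  simp only [sum_addChord_U, hold, h0, h1, Finset.sum_add_distrib, joinClass_chordOld_chordNew, hc,
    joinClass_self, e0, e1, joinClass_chordNew_chordNew k l D (zero_ne_one),
    joinClass_chordNew_chordNew k l D (one_ne_zero), ← hL, opH_graphClass]
  simp only [hk (D.label _ = i), hk' _ (D.label _ = j), ← Finset.smul_sum, kron,
    @eq_comm _ k, @eq_comm _ l]
  simp only [hk (i = _) (j = _)]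
  split_ifs <;> simp <;> module

theorem lie_opΛ_opL (i j k l : Fin g) :
    ⁅opΛ n i j, opL n k l⁆ =
      ((n : ℂ) / 2 * (kron i l * kron j k + kron i k * kron j l)) • 1 -
        (1 / 4 : ℂ) • (kron i k • opH n j l + kron i l • opH n j k +
          kron j k • opH n i l + kron j l • opH n i k) := by
  refine GraphSpaceO.hom_ext fun D => ?_
  rw [LieRing.of_associative_ring_bracket]
  simp only [LinearMap.sub_apply, Module.End.mul_apply, LinearMap.smul_apply, LinearMap.add_apply,
    Module.End.one_apply, opL_graphClass, opΛ_graphClass, joinSum_addChord, map_smul]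
  module

theorem lie_opH_opL (i j k l : Fin g) :
    ⁅opH n k l, opL n i j⁆ = kron k i • opL n l j + kron k j • opL n i l := by
  classical
  refine GraphSpaceO.hom_ext fun D => ?_
  have hold : ∀ u, (D.addChord i j).label (D.chordOld i j u) = D.label u := fun _ => rfl
  have h0 : (D.addChord i j).label (D.chordNew i j 0) = i := rfl
  have h1 : (D.addChord i j).label (D.chordNew i j 1) = j := rfl
  rw [LieRing.of_associative_ring_bracket]
  simp only [LinearMap.sub_apply, Module.End.mul_apply, LinearMap.smul_apply, LinearMap.add_apply,
    opL_graphClass, opH_graphClass, map_sum, apply_ite (opL n i j), map_zero, sum_addChord_U,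
    hold, h0, h1, graphClass_iso (D.relabel_addChord i j _ l),
    graphClass_iso (D.addChord_relabel_chordNew_zero i j l),
    graphClass_iso (D.addChord_relabel_chordNew_one i j l), add_sub_cancel_left, kron,
    @eq_comm _ k]
  split_ifs <;> simp

/-- After the join only the surviving ends can be relabelled, which is why `a` and `b` are excluded.
The missing terms are what makes the commutator with `opΛ` nonzero. -/
theorem opH_joinClass (k l : Fin g) (D : MarkedGraph g) (a b : D.U) : open Classical in
    opH n k l (joinClass n D a b) = ∑ u, if D.label u = k ∧ u ≠ a ∧ u ≠ b then
      joinClass n (D.relabel u l) a b else 0 := by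
  classical
  by_cases h : a = b
  · subst h
    rw [joinClass_self, map_zero]
    refine (Finset.sum_eq_zero fun u _ => ?_).symm
    split_ifs
    · exact joinClass_self (D.relabel u l) a
    · rfl
  · rw [joinClass_of_ne D a b h, opH_graphClass]
    refine (sum_subtype_eq_sum_dite (P := fun u => u ≠ a ∧ u ≠ b) _).trans ?_
    refine Finset.sum_congr rfl fun u _ => ?_
    by_cases hu : u ≠ a ∧ u ≠ b
    · rw [dif_pos hu]
      simp only [hu, and_true, ne_eq, not_false_eq_true]
      refine if_congr Iff.rfl ?_ rfl
      refine (graphClass_iso (D.relabel_join h ⟨u, hu⟩ l)).trans ?_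
      exact (joinClass_of_ne (D.relabel u l) a b h).symm
    · rw [dif_neg hu, if_neg fun h' => hu h'.2]

theorem joinClass_relabel_of_mem (D : MarkedGraph g) (u a b : D.U) (hu : u = a ∨ u = b)
    (l : Fin g) : joinClass n (D.relabel u l) a b = joinClass n D a b := by
  by_cases h : a = b
  · subst h
    exact (joinClass_self (D.relabel u l) a).trans (joinClass_self D a).symm
  · rw [joinClass_of_ne D a b h]
    exact (joinClass_of_ne (D.relabel u l) a b h).trans
      (graphClass_iso (D.relabel_join_of_mem h u hu l))

/-- If the relabelled end is not joined, the term belongs to relabelling after joining. If it is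
joined, its new marking `l` must be the one required at its position, and its old marking was `k`;
this gives the two correction terms. -/
theorem sum_joinSum_relabel (i j k l : Fin g) (D : MarkedGraph g) : open Classical in
    (∑ u, if D.label u = k then joinSum n i j (D.relabel u l) else 0) =
      opH n k l (joinSum n i j D) + kron i l • joinSum n k j D + kron j l • joinSum n i k D := by
  classical
  have e1 : ∀ u, joinSum n i j (D.relabel u l) = ∑ a : D.U, ∑ b : D.U,
      if (if a = u then l else D.label a) = i ∧ (if b = u then l else D.label b) = j then
        joinClass n (D.relabel u l) a b else 0 := by
    intro u
    refine (Fintype.sum_prod_type _).trans ?_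
    refine Finset.sum_congr rfl fun a _ => Finset.sum_congr rfl fun b _ => ?_
    exact if_congr (Iff.of_eq (congrArg₂ (fun x y => x = i ∧ y = j)
      (D.relabel_label u a l) (D.relabel_label u b l))) rfl rfl
  -- The classification for one relabelled end `u` and one pair `(a, b)`. For `a = b` every term is
  -- zero, so the cases `u = a` and `u = b` never overlap in a nonzero term.
  have e2 : ∀ u a b : D.U, (if D.label u = k then
      (if (if a = u then l else D.label a) = i ∧ (if b = u then l else D.label b) = j then
        joinClass n (D.relabel u l) a b else 0) else 0) =
      ((if D.label a = i ∧ D.label b = j then (if D.label u = k ∧ u ≠ a ∧ u ≠ b then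
        joinClass n (D.relabel u l) a b else 0) else 0) +
      (if u = a then kron i l • (if D.label a = k ∧ D.label b = j then
        joinClass n D a b else 0) else 0)) +
      (if u = b then kron j l • (if D.label a = i ∧ D.label b = k then
        joinClass n D a b else 0) else 0) := by
    intro u a b
    by_cases hab : a = b
    · subst hab
      rw [joinClass_self, show joinClass n (D.relabel u l) a a = 0 from
        joinClass_self (D.relabel u l) a]
      simp
    · by_cases hua : u = a
      · subst hua
        rw [joinClass_relabel_of_mem D u u b (Or.inl rfl)]
        simp only [if_true, if_neg (Ne.symm hab), if_neg hab, kron, @eq_comm _ i l]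
        by_cases h1 : D.label u = k <;> by_cases h2 : D.label b = j <;> by_cases h3 : l = i <;>
          simp [h1, h2, h3]
      · by_cases hub : u = b
        · subst hub
          rw [joinClass_relabel_of_mem D u a u (Or.inr rfl)]
          simp only [if_true, if_neg hab, if_neg hua, kron, @eq_comm _ j l]
          by_cases h1 : D.label u = k <;> by_cases h2 : D.label a = i <;>
            by_cases h3 : l = j <;> simp [h1, h2, h3]
        · simp only [if_neg hua, if_neg hub, if_neg (Ne.symm hua), if_neg (Ne.symm hub)]
          by_cases h1 : D.label u = k <;> simp [h1, hua, hub]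
  simp only [e1]
  simp only [joinSum, Fintype.sum_prod_type, map_sum, apply_ite (opH n k l), map_zero,
    opH_joinClass, Finset.smul_sum]
  have e3 : ∀ u, (if D.label u = k then ∑ a : D.U, ∑ b : D.U,
      (if (if a = u then l else D.label a) = i ∧ (if b = u then l else D.label b) = j then
        joinClass n (D.relabel u l) a b else 0) else 0) = ∑ a : D.U, ∑ b : D.U,
      if D.label u = k then
      (if (if a = u then l else D.label a) = i ∧ (if b = u then l else D.label b) = j then
        joinClass n (D.relabel u l) a b else 0) else 0 := by
    intro u
    split_ifs <;> simp
  simp only [e3, e2]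
  rw [Finset.sum_comm, ← Finset.sum_add_distrib, ← Finset.sum_add_distrib]
  refine Finset.sum_congr rfl fun a _ => ?_
  rw [Finset.sum_comm, ← Finset.sum_add_distrib, ← Finset.sum_add_distrib]
  refine Finset.sum_congr rfl fun b _ => ?_
  rw [Finset.sum_add_distrib, Finset.sum_add_distrib]
  congr 1
  · congr 1
    · split_ifs <;> simp
    · simp
  · simp

theorem lie_opH_opΛ (i j k l : Fin g) :
    ⁅opH n k l, opΛ n i j⁆ = -(kron i l • opΛ n k j) - kron j l • opΛ n i k := by
  classical
  refine GraphSpaceO.hom_ext fun D => ?_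
  have h1 : opΛ n i j (opH n k l (graphClass n D)) = (-1 / 4 : ℂ) •
      ∑ u, if D.label u = k then joinSum n i j (D.relabel u l) else 0 := by
    rw [opH_graphClass, map_sum, Finset.smul_sum]
    refine Finset.sum_congr rfl fun u _ => ?_
    split_ifs
    · exact opΛ_graphClass i j _
    · simp
  rw [LieRing.of_associative_ring_bracket]
  simp only [LinearMap.sub_apply, Module.End.mul_apply, LinearMap.smul_apply, LinearMap.neg_apply,
    h1, sum_joinSum_relabel, opΛ_graphClass, map_smul]
  module

/-- Separates the relabelling of two distinct ends from relabelling the same end twice. The double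
sum is symmetric in the two operators and cancels in the commutator; only the second term survives.
-/
theorem opH_opH_graphClass (i j k l : Fin g) (D : MarkedGraph g) : open Classical in
    opH n i j (opH n k l (graphClass n D)) =
      (∑ u, ∑ w, if D.label u = k ∧ D.label w = i ∧ u ≠ w then
        graphClass n ((D.relabel u l).relabel w j) else 0) +
      kron i l • opH n k j (graphClass n D) := by
  classical
  rw [opH_graphClass, opH_graphClass, map_sum, Finset.smul_sum, ← Finset.sum_add_distrib]
  refine Finset.sum_congr rfl fun u _ => ?_
  by_cases hu : D.label u = k
  · simp only [hu, if_true, true_and]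
    rw [opH_graphClass]
    have : ∀ w : D.U, (if (D.relabel u l).label w = i then
        graphClass n ((D.relabel u l).relabel w j) else 0) =
        (if D.label w = i ∧ u ≠ w then graphClass n ((D.relabel u l).relabel w j) else 0) +
        if w = u then kron i l • graphClass n (D.relabel u j) else 0 := by
      intro w
      rw [relabel_label]
      by_cases hw : w = u
      · subst hw
        simp [relabel_relabel_self, kron, @eq_comm _ i]
      · simp [hw, Ne.symm hw]
    refine (Finset.sum_congr rfl fun w _ => this w).trans ?_
    refine (Finset.sum_add_distrib (s := (Finset.univ : Finset D.U))).trans ?_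
    congr 1
    exact (Finset.sum_ite_eq' (Finset.univ : Finset D.U) u _).trans (by simp)
  · simp [hu]

theorem lie_opH_opH (i j k l : Fin g) :
    ⁅opH n i j, opH n k l⁆ = kron i l • opH n k j - kron k j • opH n i l := by
  classical
  refine GraphSpaceO.hom_ext fun D => ?_
  rw [LieRing.of_associative_ring_bracket]
  simp only [LinearMap.sub_apply, Module.End.mul_apply, LinearMap.smul_apply, opH_opH_graphClass]
  rw [Finset.sum_comm]
  have : (∑ w, ∑ u, if D.label u = k ∧ D.label w = i ∧ u ≠ w then
        graphClass n ((D.relabel u l).relabel w j) else 0) =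
      ∑ w, ∑ u, if D.label w = i ∧ D.label u = k ∧ w ≠ u then
        graphClass n ((D.relabel w j).relabel u l) else 0 := by
    refine Finset.sum_congr rfl fun w _ => Finset.sum_congr rfl fun u _ => ?_
    split_ifs with h h' h' <;> first | rfl | (exfalso; tauto) | rw [relabel_relabel_comm _ h.2.2]
  rw [this]
  abel

theorem lie_opL_opL (i j k l : Fin g) : ⁅opL n i j, opL n k l⁆ = 0 := by
  refine GraphSpaceO.hom_ext fun D => ?_
  rw [LieRing.of_associative_ring_bracket]
  simp only [LinearMap.sub_apply, Module.End.mul_apply, opL_graphClass, LinearMap.zero_apply,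
    graphClass_iso (D.addChord_addChord i j k l), sub_self]

open Classical in
/-- The class of the graph with two pairs of ends joined, and zero if they are not distinct. -/
noncomputable def joinJoinClass (n : ℕ) (D : MarkedGraph g) (a b c d : D.U) : GraphSpaceO g n :=
  if h : a ≠ b ∧ (c ≠ a ∧ c ≠ b) ∧ (d ≠ a ∧ d ≠ b) then
    joinClass n (D.join a b h.1) ⟨c, h.2.1⟩ ⟨d, h.2.2⟩ else 0

/-- Apart from degenerate choices of ends, where both sides are zero, this is `join_join`. -/
theorem joinJoinClass_comm (D : MarkedGraph g) (a b c d : D.U) :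
    joinJoinClass n D a b c d = joinJoinClass n D c d a b := by
  unfold joinJoinClass
  -- The defining condition of `joinJoinClass` does not ask for `c ≠ d`; that degeneracy is handled
  -- by `joinClass`, so it is treated separately.
  by_cases hcd : c = d
  · subst hcd
    rw [dif_neg (fun h : c ≠ c ∧ _ => h.1 rfl)]
    split_ifs
    · exact joinClass_self _ _
    · rfl
  by_cases h : a ≠ b ∧ (c ≠ a ∧ c ≠ b) ∧ (d ≠ a ∧ d ≠ b)
  · have h' : c ≠ d ∧ (a ≠ c ∧ a ≠ d) ∧ (b ≠ c ∧ b ≠ d) :=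
      ⟨hcd, ⟨h.2.1.1.symm, h.2.2.1.symm⟩, h.2.1.2.symm, h.2.2.2.symm⟩
    rw [dif_pos h, dif_pos h']
    refine (joinClass_of_ne (D.join a b h.1) ⟨c, h.2.1⟩ ⟨d, h.2.2⟩
      fun e => hcd (congrArg Subtype.val e)).trans ?_
    refine Eq.trans ?_ (joinClass_of_ne (D.join c d hcd) ⟨a, h'.2.1⟩ ⟨b, h'.2.2⟩
      fun e => h.1 (congrArg Subtype.val e)).symm
    exact graphClass_iso (D.join_join h.1 hcd h.2.1 h.2.2 h'.2.1 h'.2.2)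
  · rw [dif_neg h]
    split_ifs with h'
    · by_cases hab : a = b
      · subst hab
        exact (joinClass_self _ _).symm
      · exact absurd ⟨hab, ⟨h'.2.1.1.symm, h'.2.2.1.symm⟩, h'.2.1.2.symm, h'.2.2.2.symm⟩ h
    · rfl

theorem opΛ_joinClass (k l : Fin g) (D : MarkedGraph g) (a b : D.U) : open Classical in
    opΛ n k l (joinClass n D a b) = (-1 / 4 : ℂ) • ∑ c, ∑ d,
      if D.label c = k ∧ D.label d = l then joinJoinClass n D a b c d else 0 := by
  classical
  by_cases h : a = b
  · subst h
    rw [joinClass_self, map_zero]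
    simp [joinJoinClass]
  · rw [joinClass_of_ne D a b h, opΛ_graphClass, joinSum, Fintype.sum_prod_type]
    congr 1
    refine (sum_subtype_eq_sum_dite (P := fun u => u ≠ a ∧ u ≠ b) _).trans ?_
    refine Finset.sum_congr rfl fun c _ => ?_
    by_cases hc : c ≠ a ∧ c ≠ b
    · rw [dif_pos hc]
      refine (sum_subtype_eq_sum_dite (P := fun u => u ≠ a ∧ u ≠ b) _).trans ?_
      refine Finset.sum_congr rfl fun d _ => ?_
      by_cases hd : d ≠ a ∧ d ≠ b
      · rw [dif_pos hd]
        refine if_congr Iff.rfl ?_ rfl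
        rw [joinJoinClass, dif_pos ⟨h, hc, hd⟩]
      · rw [dif_neg hd, joinJoinClass, dif_neg fun h' => hd h'.2.2, ite_self]
    · rw [dif_neg hc]
      refine (Finset.sum_eq_zero fun d _ => ?_).symm
      rw [joinJoinClass, dif_neg fun h' => hc h'.2.1, ite_self]

theorem opΛ_opΛ_graphClass (i j k l : Fin g) (D : MarkedGraph g) : open Classical in
    opΛ n k l (opΛ n i j (graphClass n D)) = (1 / 16 : ℂ) •
      ∑ p : D.U × D.U, ∑ q : D.U × D.U, if (D.label p.1 = i ∧ D.label p.2 = j) ∧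
        D.label q.1 = k ∧ D.label q.2 = l then joinJoinClass n D p.1 p.2 q.1 q.2 else 0 := by
  classical
  rw [opΛ_graphClass, map_smul, joinSum, map_sum, show (1 / 16 : ℂ) = (-1 / 4) * (-1 / 4) by norm_num,
    mul_smul]
  congr 1
  rw [Finset.smul_sum]
  refine Finset.sum_congr rfl fun p _ => ?_
  split_ifs with h
  · rw [opΛ_joinClass, Fintype.sum_prod_type]
    simp [h]
  · simp [h]

theorem lie_opΛ_opΛ (i j k l : Fin g) : ⁅opΛ n i j, opΛ n k l⁆ = 0 := by
  classical
  refine GraphSpaceO.hom_ext fun D => ?_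
  rw [LieRing.of_associative_ring_bracket]
  simp only [LinearMap.sub_apply, Module.End.mul_apply, LinearMap.zero_apply, opΛ_opΛ_graphClass]
  rw [Finset.sum_comm, sub_eq_zero]
  congr 1
  refine Finset.sum_congr rfl fun p _ => Finset.sum_congr rfl fun q _ => ?_
  rw [joinJoinClass_comm]
  exact if_congr and_comm rfl rfl

theorem opL_comm (i j : Fin g) : opL n i j = opL n j i :=
  GraphSpaceO.hom_ext fun D => by
    rw [opL_graphClass, opL_graphClass, graphClass_iso (D.addChord_swap i j)]

theorem opΛ_comm (i j : Fin g) : opΛ n i j = opΛ n j i :=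
  GraphSpaceO.hom_ext fun D => by
    classical
    rw [opΛ_graphClass, opΛ_graphClass, joinSum, joinSum, Fintype.sum_prod_type,
      Fintype.sum_prod_type_right]
    congr 1
    refine Finset.sum_congr rfl fun a _ => Finset.sum_congr rfl fun b _ => ?_
    rw [joinClass_comm]
    exact if_congr and_comm rfl rfl

end operators

/-! ### The representation of the symplectic Lie algebra -/

section rho

open Matrix

variable (n : ℕ)

theorem single_mul_single_eq_kron (i j k l : Fin g) (a b : ℂ) :
    single i j a * single k l b = kron j k • single i l (a * b) := by
  unfold kron
  split_ifs with h
  · subst h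
    simp
  · simp [h]

theorem kron_comm (i j : Fin g) : kron i j = kron j i := by
  simp only [kron, eq_comm]

/-- The part of the representation on matrices with zero lower left and diagonal blocks. -/
noncomputable def rhoL : Matrix (Fin g) (Fin g) ℂ →ₗ[ℂ] Module.End ℂ (GraphSpaceO g n) :=
  ∑ i, ∑ j, (entryLinearMap ℂ ℂ i j).smulRight (opL n i j)

/-- The part of the representation on matrices with zero upper right and diagonal blocks. -/
noncomputable def rhoΛ : Matrix (Fin g) (Fin g) ℂ →ₗ[ℂ] Module.End ℂ (GraphSpaceO g n) :=
  ∑ i, ∑ j, (entryLinearMap ℂ ℂ i j).smulRight (opΛ n i j)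

/-- The part of the representation on block diagonal matrices. -/
noncomputable def rhoH : Matrix (Fin g) (Fin g) ℂ →ₗ[ℂ] Module.End ℂ (GraphSpaceO g n) :=
  ∑ i, ∑ j, (entryLinearMap ℂ ℂ j i).smulRight (opH n i j - ((n : ℂ) * kron i j) • 1)

theorem rhoL_single (i j : Fin g) (c : ℂ) : rhoL n (single i j c) = c • opL n i j := by
  simp only [rhoL, LinearMap.sum_apply, LinearMap.smulRight_apply, entryLinearMap_apply, single_apply]
  rw [Fintype.sum_eq_single i (fun k hk => Finset.sum_eq_zero fun l _ => by simp [hk.symm]),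
    Fintype.sum_eq_single j (fun l hl => by simp [hl.symm])]
  simp

theorem rhoΛ_single (i j : Fin g) (c : ℂ) : rhoΛ n (single i j c) = c • opΛ n i j := by
  simp only [rhoΛ, LinearMap.sum_apply, LinearMap.smulRight_apply, entryLinearMap_apply, single_apply]
  rw [Fintype.sum_eq_single i (fun k hk => Finset.sum_eq_zero fun l _ => by simp [hk.symm]),
    Fintype.sum_eq_single j (fun l hl => by simp [hl.symm])]
  simp

theorem rhoH_single (i j : Fin g) (c : ℂ) :
    rhoH n (single j i c) = c • (opH n i j - ((n : ℂ) * kron i j) • 1) := by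
  simp only [rhoH, LinearMap.sum_apply, LinearMap.smulRight_apply, entryLinearMap_apply, single_apply]
  rw [Fintype.sum_eq_single i (fun k hk => Finset.sum_eq_zero fun l _ => by simp [hk.symm]),
    Fintype.sum_eq_single j (fun l hl => by simp [hl.symm])]
  simp

/-- Both sides are bilinear, so matrix units suffice. For this reason `rhoL` is defined on all
matrices and not only on symmetric ones; it depends only on the symmetric part because `opL` is
symmetric in its indices. The scalar shift in `rhoH` is central and drops out. -/
theorem lie_rhoH_rhoL (A B : Matrix (Fin g) (Fin g) ℂ) :
    ⁅rhoH n A, rhoL n B⁆ = rhoL n (A * B + B * Aᵀ) := by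
  induction A using Matrix.induction_on' with
  | h_zero => simp
  | h_add A A' hA hA' =>
    rw [map_add, add_lie, hA, hA', ← map_add]
    congr 1
    rw [transpose_add]
    noncomm_ring
  | h_std_basis i j x =>
  induction B using Matrix.induction_on' with
  | h_zero => simp
  | h_add B B' hB hB' =>
    rw [map_add, lie_add, hB, hB', ← map_add]
    congr 1
    noncomm_ring
  | h_std_basis k l y =>
    simp only [rhoL_single, rhoH_single, transpose_single, single_mul_single_eq_kron, map_add,
      map_smul, smul_lie, lie_smul, sub_lie, lie_opH_opL]
    rw [kron_comm l j, opL_comm k i, LieRing.of_associative_ring_bracket]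
    simp only [one_mul, mul_one, sub_self]
    module

theorem lie_rhoH_rhoΛ (A C : Matrix (Fin g) (Fin g) ℂ) :
    ⁅rhoH n A, rhoΛ n C⁆ = -rhoΛ n (Aᵀ * C + C * A) := by
  induction A using Matrix.induction_on' with
  | h_zero => simp
  | h_add A A' hA hA' =>
    rw [map_add, add_lie, hA, hA', ← neg_add, ← map_add]
    congr 2
    rw [transpose_add]
    noncomm_ring
  | h_std_basis i j x =>
  induction C using Matrix.induction_on' with
  | h_zero => simp
  | h_add B B' hB hB' =>
    rw [map_add, lie_add, hB, hB', ← neg_add, ← map_add]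
    congr 2
    noncomm_ring
  | h_std_basis k l y =>
    simp only [rhoΛ_single, rhoH_single, transpose_single, single_mul_single_eq_kron, map_add,
      map_smul, smul_lie, lie_smul, sub_lie, lie_opH_opΛ]
    rw [kron_comm i k, LieRing.of_associative_ring_bracket]
    simp only [one_mul, mul_one, sub_self]
    module

theorem lie_rhoH_rhoH (A B : Matrix (Fin g) (Fin g) ℂ) :
    ⁅rhoH n A, rhoH n B⁆ = rhoH n (A * B - B * A) := by
  induction A using Matrix.induction_on' with
  | h_zero => simp
  | h_add A A' hA hA' =>
    rw [map_add, add_lie, hA, hA', ← map_add]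
    congr 1
    noncomm_ring
  | h_std_basis i j x =>
  induction B using Matrix.induction_on' with
  | h_zero => simp
  | h_add B B' hB hB' =>
    rw [map_add, lie_add, hB, hB', ← map_add]
    congr 1
    noncomm_ring
  | h_std_basis k l y =>
    have h : ∀ (S T : Module.End ℂ (GraphSpaceO g n)) (a b : ℂ),
        ⁅S - a • 1, T - b • 1⁆ = ⁅S, T⁆ := by
      intro S T a b
      rw [LieRing.of_associative_ring_bracket, LieRing.of_associative_ring_bracket]
      simp only [sub_mul, mul_sub, smul_mul_assoc, mul_smul_comm, one_mul, mul_one]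
      module
    simp only [rhoH_single, single_mul_single_eq_kron, map_sub, map_smul, smul_lie, lie_smul, h,
      lie_opH_opH]
    module

/-- This bracket fixes the shift of `opH` by `-n` on the diagonal: the shift accounts exactly for
the scalar term of `lie_opΛ_opL`. The symmetrizations appear because `B` and `C` are arbitrary; for
symmetric matrices the right side is `-rhoH n (B * C)`. -/
theorem lie_rhoΛ_rhoL (C B : Matrix (Fin g) (Fin g) ℂ) :
    ⁅rhoΛ n C, rhoL n B⁆ = (-1 / 4 : ℂ) • rhoH n ((B + Bᵀ) * (C + Cᵀ)) := by
  induction C using Matrix.induction_on' with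
  | h_zero => simp
  | h_add A A' hA hA' =>
    rw [map_add, add_lie, hA, hA', ← smul_add, ← map_add]
    congr 2
    rw [transpose_add]
    noncomm_ring
  | h_std_basis i j x =>
  induction B using Matrix.induction_on' with
  | h_zero => simp
  | h_add B B' hB hB' =>
    rw [map_add, lie_add, hB, hB', ← smul_add, ← map_add]
    congr 2
    rw [transpose_add]
    noncomm_ring
  | h_std_basis k l y =>
    simp only [rhoΛ_single, rhoL_single, transpose_single, mul_add, add_mul,
      single_mul_single_eq_kron, map_add, rhoH_single, map_smul, smul_lie, lie_smul, lie_opΛ_opL]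
    rw [kron_comm l i, kron_comm l j, kron_comm k i, kron_comm k j]
    module

theorem lie_rhoL_rhoL (A B : Matrix (Fin g) (Fin g) ℂ) : ⁅rhoL n A, rhoL n B⁆ = 0 := by
  induction A using Matrix.induction_on' with
  | h_zero => simp
  | h_add A A' hA hA' => rw [map_add, add_lie, hA, hA', add_zero]
  | h_std_basis i j x =>
  induction B using Matrix.induction_on' with
  | h_zero => simp
  | h_add B B' hB hB' => rw [map_add, lie_add, hB, hB', add_zero]
  | h_std_basis k l y => simp [rhoL_single, lie_opL_opL]

theorem lie_rhoΛ_rhoΛ (A B : Matrix (Fin g) (Fin g) ℂ) : ⁅rhoΛ n A, rhoΛ n B⁆ = 0 := by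
  induction A using Matrix.induction_on' with
  | h_zero => simp
  | h_add A A' hA hA' => rw [map_add, add_lie, hA, hA', add_zero]
  | h_std_basis i j x =>
  induction B using Matrix.induction_on' with
  | h_zero => simp
  | h_add B B' hB hB' => rw [map_add, lie_add, hB, hB', add_zero]
  | h_std_basis k l y => simp [rhoΛ_single, lie_opΛ_opΛ]

/-- Comparing blocks in the skew-adjointness condition for `J`. The lower right block is determined
by the upper left one, so `rho` does not need to look at it. -/
theorem exists_blocks_of_mem_sp {X : Matrix (Fin g ⊕ Fin g) (Fin g ⊕ Fin g) ℂ}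
    (hX : X ∈ LieAlgebra.Symplectic.sp (Fin g) ℂ) :
    ∃ A B C : Matrix (Fin g) (Fin g) ℂ, X = fromBlocks A B C (-Aᵀ) ∧ Bᵀ = B ∧ Cᵀ = C := by
  have h : Xᵀ * J (Fin g) ℂ = J (Fin g) ℂ * -X := by
    simpa [LieAlgebra.Symplectic.sp, Matrix.IsSkewAdjoint, Matrix.IsAdjointPair] using hX
  rw [← fromBlocks_toBlocks X, J, fromBlocks_transpose, fromBlocks_neg, fromBlocks_multiply,
    fromBlocks_multiply, fromBlocks_inj] at h
  simp only [mul_zero, mul_one, zero_mul, one_mul, zero_add, add_zero, mul_neg, neg_mul, neg_neg, neg_zero]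
    at h
  obtain ⟨h1, h2, -, h4⟩ := h
  refine ⟨X.toBlocks₁₁, _, _, ?_, neg_injective h4, h1⟩
  rw [h2, fromBlocks_toBlocks]

/-- The representation of the symplectic Lie algebra. -/
noncomputable def rho : LieAlgebra.Symplectic.sp (Fin g) ℂ →ₗ⁅ℂ⁆ Module.End ℂ (GraphSpaceO g n) where
  toFun X := rhoL n X.1.toBlocks₁₂ + rhoΛ n X.1.toBlocks₂₁ + rhoH n X.1.toBlocks₁₁
  map_add' X Y := by
    have h1 : (X + Y).1.toBlocks₁₂ = X.1.toBlocks₁₂ + Y.1.toBlocks₁₂ := rfl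
    have h2 : (X + Y).1.toBlocks₂₁ = X.1.toBlocks₂₁ + Y.1.toBlocks₂₁ := rfl
    have h3 : (X + Y).1.toBlocks₁₁ = X.1.toBlocks₁₁ + Y.1.toBlocks₁₁ := rfl
    rw [h1, h2, h3, map_add, map_add, map_add]
    abel
  map_smul' c X := by
    have h1 : (c • X).1.toBlocks₁₂ = c • X.1.toBlocks₁₂ := rfl
    have h2 : (c • X).1.toBlocks₂₁ = c • X.1.toBlocks₂₁ := rfl
    have h3 : (c • X).1.toBlocks₁₁ = c • X.1.toBlocks₁₁ := rfl
    rw [h1, h2, h3, map_smul, map_smul, map_smul, RingHom.id_apply, smul_add, smul_add]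
  map_lie' := by
    rintro ⟨X, hX⟩ ⟨Y, hY⟩
    obtain ⟨A, B, C, rfl, hB, hC⟩ := exists_blocks_of_mem_sp hX
    obtain ⟨A', B', C', rfl, hB', hC'⟩ := exists_blocks_of_mem_sp hY
    have h0 : (⁅(⟨_, hX⟩ : LieAlgebra.Symplectic.sp (Fin g) ℂ),
        (⟨_, hY⟩ : LieAlgebra.Symplectic.sp (Fin g) ℂ)⁆).1 =
      fromBlocks A B C (-Aᵀ) * fromBlocks A' B' C' (-A'ᵀ) -
        fromBlocks A' B' C' (-A'ᵀ) * fromBlocks A B C (-Aᵀ) := rfl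
    have s11 : ∀ M N : Matrix (Fin g ⊕ Fin g) (Fin g ⊕ Fin g) ℂ,
      (M - N).toBlocks₁₁ = M.toBlocks₁₁ - N.toBlocks₁₁ := fun _ _ => rfl
    have s12 : ∀ M N : Matrix (Fin g ⊕ Fin g) (Fin g ⊕ Fin g) ℂ,
      (M - N).toBlocks₁₂ = M.toBlocks₁₂ - N.toBlocks₁₂ := fun _ _ => rfl
    have s21 : ∀ M N : Matrix (Fin g ⊕ Fin g) (Fin g ⊕ Fin g) ℂ,
      (M - N).toBlocks₂₁ = M.toBlocks₂₁ - N.toBlocks₂₁ := fun _ _ => rfl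
    dsimp only at h0 ⊢
    rw [h0]
    -- `lie_skew` brings the mixed brackets into the order of the preceding lemmas, and symmetry
    -- turns each symmetrized block into twice the block, so that the factor `-1 / 4` cancels.
    simp only [fromBlocks_multiply, s11, s12, s21, toBlocks_fromBlocks₁₁, toBlocks_fromBlocks₁₂,
      toBlocks_fromBlocks₂₁, add_lie, lie_add, lie_rhoL_rhoL, lie_rhoΛ_rhoΛ, lie_rhoΛ_rhoL,
      lie_rhoH_rhoL, lie_rhoH_rhoΛ, lie_rhoH_rhoH, ← lie_skew (rhoL n B) (rhoΛ n C'),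
      ← lie_skew (rhoL n B) (rhoH n A'), ← lie_skew (rhoΛ n C) (rhoH n A'), hB, hB', hC, hC',
      ← two_smul ℂ, smul_mul_assoc, mul_smul_comm, map_smul, map_add, map_sub, mul_neg, neg_mul,
      map_neg]
    module

theorem rho_apply (X : LieAlgebra.Symplectic.sp (Fin g) ℂ) :
    rho n X = rhoL n X.1.toBlocks₁₂ + rhoΛ n X.1.toBlocks₂₁ + rhoH n X.1.toBlocks₁₁ := rfl

theorem rho_spL (i j : Fin g) : rho n (spL i j) = opL n i j := by
  simp only [rho_apply, spL, toBlocks_fromBlocks₁₁, toBlocks_fromBlocks₁₂, toBlocks_fromBlocks₂₁,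
    map_zero, add_zero, symUnit, map_smul, map_add, rhoL_single, opL_comm j i]
  module

theorem rho_spΛ (i j : Fin g) : rho n (spΛ i j) = opΛ n i j := by
  simp only [rho_apply, spΛ, toBlocks_fromBlocks₁₁, toBlocks_fromBlocks₁₂, toBlocks_fromBlocks₂₁,
    map_zero, add_zero, zero_add, symUnit, map_smul, map_add, rhoΛ_single, opΛ_comm j i]
  module

theorem rho_spH (i j : Fin g) :
    rho n (spH i j) = opH n i j - ((n : ℂ) * kron i j) • 1 := by
  simp only [rho_apply, spH, toBlocks_fromBlocks₁₁, toBlocks_fromBlocks₁₂, toBlocks_fromBlocks₂₁,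
    map_zero, zero_add, rhoH_single, one_smul]

end rho

/-! ### Extension of operators to the completion -/

section completion

variable {n : ℕ}

/-- Operators which lower the total degree by at most one. -/
def degreeLowering (g n : ℕ) : Submodule ℂ (Module.End ℂ (GraphSpaceO g n)) where
  carrier := {T | ∀ d, degreeFiltration g n (d + 1) ≤ (degreeFiltration g n d).comap T}
  add_mem' := fun hS hT d _ hx => Submodule.add_mem (degreeFiltration g n d) (hS d hx) (hT d hx)
  zero_mem' := fun d _ _ => zero_mem (degreeFiltration g n d)
  smul_mem' := fun c _ hT d _ hx => Submodule.smul_mem (degreeFiltration g n d) c (hT d hx)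

theorem mem_degreeLowering {T : Module.End ℂ (GraphSpaceO g n)} : T ∈ degreeLowering g n ↔
    ∀ d, degreeFiltration g n (d + 1) ≤ (degreeFiltration g n d).comap T := Iff.rfl

theorem mem_degreeLowering_of_graphClass {T : Module.End ℂ (GraphSpaceO g n)}
    (h : ∀ (d : ℕ) (D : MarkedGraph g), d + 1 ≤ D.degree →
      T (graphClass n D) ∈ degreeFiltration g n d) : T ∈ degreeLowering g n := by
  refine mem_degreeLowering.2 fun d => ?_
  rw [degreeFiltration, Submodule.span_le]
  rintro _ ⟨D, hD, rfl⟩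
  exact h d D hD

theorem graphClass_mem_degreeFiltration (D : MarkedGraph g) {d : ℕ} (h : d ≤ D.degree) :
    graphClass n D ∈ degreeFiltration g n d :=
  Submodule.subset_span ⟨D, h, rfl⟩

theorem opL_mem_degreeLowering (i j : Fin g) : opL n i j ∈ degreeLowering g n :=
  mem_degreeLowering_of_graphClass fun d D hD => by
    rw [opL_graphClass]
    exact graphClass_mem_degreeFiltration _ (by rw [degree_addChord]; omega)

theorem opH_mem_degreeLowering (i j : Fin g) : opH n i j ∈ degreeLowering g n :=
  mem_degreeLowering_of_graphClass fun d D hD => by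
    classical
    rw [opH_graphClass]
    refine Submodule.sum_mem _ fun u _ => ?_
    split_ifs
    · have : (D.relabel u j).degree = D.degree := rfl
      exact graphClass_mem_degreeFiltration _ (by omega)
    · exact zero_mem _

theorem opΛ_mem_degreeLowering (i j : Fin g) : opΛ n i j ∈ degreeLowering g n :=
  mem_degreeLowering_of_graphClass fun d D hD => by
    classical
    rw [opΛ_graphClass]
    refine Submodule.smul_mem _ _ (Submodule.sum_mem _ fun p _ => ?_)
    split_ifs
    · by_cases h : p.1 = p.2
      · rw [h, joinClass_self]
        exact zero_mem _
      · rw [joinClass_of_ne _ _ _ h]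
        have := D.degree_join p.1 p.2 h
        exact graphClass_mem_degreeFiltration _ (by omega)
    · exact zero_mem _

theorem one_mem_degreeLowering : (1 : Module.End ℂ (GraphSpaceO g n)) ∈ degreeLowering g n :=
  mem_degreeLowering.2 fun d _ hx => degreeFiltration_anti g n (Nat.le_succ d) hx

/-- A submodule of operators which contains the generators contains the representation. -/
theorem rho_mem {S : Submodule ℂ (Module.End ℂ (GraphSpaceO g n))} (hL : ∀ i j, opL n i j ∈ S)
    (hH : ∀ i j, opH n i j ∈ S) (hΛ : ∀ i j, opΛ n i j ∈ S) (h1 : 1 ∈ S)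
    (X : LieAlgebra.Symplectic.sp (Fin g) ℂ) : rho n X ∈ S := by
  rw [rho_apply, rhoL, rhoΛ, rhoH]
  simp only [LinearMap.sum_apply, LinearMap.smulRight_apply]
  refine add_mem (add_mem ?_ ?_) ?_ <;>
    refine Submodule.sum_mem _ fun i _ => Submodule.sum_mem _ fun j _ => Submodule.smul_mem _ _ ?_
  · exact hL i j
  · exact hΛ i j
  · exact sub_mem (hH i j) (Submodule.smul_mem _ _ h1)

theorem rho_mem_degreeLowering (X : LieAlgebra.Symplectic.sp (Fin g) ℂ) :
    rho n X ∈ degreeLowering g n :=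
  rho_mem opL_mem_degreeLowering opH_mem_degreeLowering opΛ_mem_degreeLowering
    one_mem_degreeLowering X

theorem completed_mkQ_of_le (y : completedGraphSpaceO g n) {d e : ℕ} (hde : d ≤ e)
    {x : GraphSpaceO g n} (h : y.1 e = (degreeFiltration g n e).mkQ x) :
    y.1 d = (degreeFiltration g n d).mkQ x := by
  rw [← y.2 d e hde, h]
  rfl

theorem completed_exists_mkQ (y : completedGraphSpaceO g n) (e : ℕ) :
    ∃ x, y.1 e = (degreeFiltration g n e).mkQ x :=
  let ⟨x, hx⟩ := (degreeFiltration g n e).mkQ_surjective (y.1 e)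
  ⟨x, hx.symm⟩

/-- The extension of an operator to the completion. -/
noncomputable def extendCompleted (T : Module.End ℂ (GraphSpaceO g n))
    (hT : T ∈ degreeLowering g n) : Module.End ℂ (completedGraphSpaceO g n) :=
  LinearMap.restrict (LinearMap.pi fun d =>
    (Submodule.mapQ (degreeFiltration g n (d + 1)) (degreeFiltration g n d) T
      (mem_degreeLowering.1 hT d)) ∘ₗ
      LinearMap.proj (d + 1)) (fun y hy d e hde => by
    obtain ⟨x, hx⟩ := completed_exists_mkQ ⟨y, hy⟩ (e + 1)
    have hx' := completed_mkQ_of_le ⟨y, hy⟩ (Nat.succ_le_succ hde) hx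
    simp only at hx hx'
    simp only [LinearMap.pi_apply, LinearMap.comp_apply, LinearMap.proj_apply]
    rw [hx, hx']
    rfl)

theorem extendCompleted_apply {T : Module.End ℂ (GraphSpaceO g n)} (hT : T ∈ degreeLowering g n)
    (y : completedGraphSpaceO g n) {d : ℕ} {x : GraphSpaceO g n}
    (h : y.1 (d + 1) = (degreeFiltration g n (d + 1)).mkQ x) :
    (extendCompleted T hT y).1 d = (degreeFiltration g n d).mkQ (T x) := by
  change Submodule.mapQ (degreeFiltration g n (d + 1)) (degreeFiltration g n d) T
      (mem_degreeLowering.1 hT d)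
    (y.1 (d + 1)) = _
  rw [h]
  rfl

theorem extendCompleted_apply_eq_zero {T : Module.End ℂ (GraphSpaceO g n)}
    (hT : T ∈ degreeLowering g n) (y : completedGraphSpaceO g n) {d : ℕ} (h : y.1 (d + 1) = 0) :
    (extendCompleted T hT y).1 d = 0 := by
  rw [extendCompleted_apply hT y (x := 0) (by rw [h, map_zero]), map_zero, map_zero]

theorem extendCompleted_toCompleted {T : Module.End ℂ (GraphSpaceO g n)}
    (hT : T ∈ degreeLowering g n) (x : GraphSpaceO g n) :
    extendCompleted T hT (toCompleted g n x) = toCompleted g n (T x) :=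
  Subtype.ext (funext fun _ => extendCompleted_apply hT _ rfl)

/-- Each operator costs one level of the filtration, so a composite at level `d` is computed from a
representative at level `d + 2`. -/
theorem extendCompleted_extendCompleted {S T : Module.End ℂ (GraphSpaceO g n)}
    (hS : S ∈ degreeLowering g n) (hT : T ∈ degreeLowering g n) (y : completedGraphSpaceO g n)
    {d : ℕ} {x : GraphSpaceO g n}
    (h : y.1 (d + 1 + 1) = (degreeFiltration g n (d + 1 + 1)).mkQ x) :
    (extendCompleted S hS (extendCompleted T hT y)).1 d =
      (degreeFiltration g n d).mkQ (S (T x)) :=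
  extendCompleted_apply hS _ (extendCompleted_apply hT y h)

/-- The representation of the symplectic Lie algebra on the completion. -/
noncomputable def rhoCompleted (n : ℕ) :
    LieAlgebra.Symplectic.sp (Fin g) ℂ →ₗ⁅ℂ⁆ Module.End ℂ (completedGraphSpaceO g n) where
  toFun X := extendCompleted (rho n X) (rho_mem_degreeLowering X)
  map_add' X Y := by
    refine LinearMap.ext fun y => Subtype.ext (funext fun d => ?_)
    obtain ⟨x, hx⟩ := completed_exists_mkQ y (d + 1)
    change _ = (extendCompleted _ _ y).1 d + (extendCompleted _ _ y).1 d
    rw [extendCompleted_apply _ y hx, extendCompleted_apply _ y hx, extendCompleted_apply _ y hx,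
      map_add, LinearMap.add_apply, map_add]
  map_smul' c X := by
    refine LinearMap.ext fun y => Subtype.ext (funext fun d => ?_)
    obtain ⟨x, hx⟩ := completed_exists_mkQ y (d + 1)
    change _ = c • (extendCompleted _ _ y).1 d
    rw [extendCompleted_apply _ y hx, extendCompleted_apply _ y hx, map_smul, LinearMap.smul_apply,
      map_smul]
  map_lie' := by
    intro X Y
    refine LinearMap.ext fun y => Subtype.ext (funext fun d => ?_)
    -- One representative, two levels up, serves both products and the bracket, and the identity
    -- reduces to the one for `rho`.
    obtain ⟨x, hx⟩ := completed_exists_mkQ y (d + 1 + 1)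
    have hX := rho_mem_degreeLowering (n := n) X
    have hY := rho_mem_degreeLowering (n := n) Y
    change _ = (extendCompleted (rho n X) hX (extendCompleted (rho n Y) hY y)).1 d -
      (extendCompleted (rho n Y) hY (extendCompleted (rho n X) hX y)).1 d
    rw [extendCompleted_apply _ y (completed_mkQ_of_le y (Nat.le_succ _) hx),
      extendCompleted_extendCompleted _ _ y hx, extendCompleted_extendCompleted _ _ y hx,
      LieHom.map_lie, LieRing.of_associative_ring_bracket, LinearMap.sub_apply, map_sub,
      Module.End.mul_apply, Module.End.mul_apply]

end completion

/-! ### The projection to graphs without trivalent vertices -/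

section projection

variable {n : ℕ}

-- AS and IHX involve only graphs that have a trivalent vertex, so all their terms are sent to zero;
-- the circle relation does not change the trivalent vertices.
open Classical in
theorem chordProj_isGraphInvariant (n : ℕ) : IsGraphInvariant n fun D : MarkedGraph g =>
    if IsEmpty D.V then graphClass n D else 0 := by
  refine ⟨fun {D E} h => ?_, fun D v => ?_, fun D v w _ _ => ?_, fun D => ?_⟩
  · obtain ⟨eV, -⟩ := id h
    exact if_congr eV.isEmpty_congr (graphClass_iso h) rfl
  · have h1 : ¬ IsEmpty D.V := fun h => h.elim v
    exact (congrArg₂ (· + ·) (if_neg h1) (if_neg h1)).trans (add_zero 0)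
  · have h1 : ¬ IsEmpty D.V := fun h => h.elim v
    exact (congrArg₂ (· + ·) (congrArg₂ (· + ·) (if_neg h1) (if_neg h1)) (if_neg h1)).trans
      (by simp)
  · by_cases h1 : IsEmpty D.V
    · exact (congrArg₂ (fun x y => x + (2 * (n : ℂ)) • y) (if_pos h1) (if_pos h1)).trans
        (graphClass_circle D)
    · exact (congrArg₂ (fun x y => x + (2 * (n : ℂ)) • y) (if_neg h1) (if_neg h1)).trans (by simp)

/-- The projection to the span of the graphs without trivalent vertices. -/
noncomputable def chordProj (g n : ℕ) : Module.End ℂ (GraphSpaceO g n) :=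
  (chordProj_isGraphInvariant n).lift

theorem chordProj_of_isEmpty {D : MarkedGraph g} (h : IsEmpty D.V) :
    chordProj g n (graphClass n D) = graphClass n D :=
  ((chordProj_isGraphInvariant n).lift_graphClass D).trans (if_pos h)

theorem chordProj_of_not_isEmpty {D : MarkedGraph g} (h : ¬ IsEmpty D.V) :
    chordProj g n (graphClass n D) = 0 :=
  ((chordProj_isGraphInvariant n).lift_graphClass D).trans (if_neg h)

/-- An operator commutes with the projection if it maps graphs to combinations of graphs with the
same trivalent vertices. -/
theorem commute_chordProj {T : Module.End ℂ (GraphSpaceO g n)}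
    (h : ∀ D : MarkedGraph g, T (graphClass n D) ∈
      Submodule.span ℂ {x | ∃ E : MarkedGraph g, E.V = D.V ∧ x = graphClass n E}) :
    chordProj g n * T = T * chordProj g n := by
  refine GraphSpaceO.hom_ext fun D => ?_
  rw [Module.End.mul_apply, Module.End.mul_apply]
  by_cases hD : IsEmpty D.V
  · rw [chordProj_of_isEmpty hD]
    refine LinearMap.eqOn_span (f := chordProj g n) (g := LinearMap.id) ?_ (h D)
    rintro _ ⟨E, hE, rfl⟩
    exact chordProj_of_isEmpty (by rwa [hE])
  · rw [chordProj_of_not_isEmpty hD, map_zero]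
    refine LinearMap.eqOn_span (f := chordProj g n) (g := 0) ?_ (h D)
    rintro _ ⟨E, hE, rfl⟩
    exact chordProj_of_not_isEmpty (by rwa [hE])

theorem chordProj_comm_rho (X : LieAlgebra.Symplectic.sp (Fin g) ℂ) (x : GraphSpaceO g n) :
    chordProj g n (rho n X x) = rho n X (chordProj g n x) := by
  classical
  -- The commutant of the projection is a linear subspace, so it is enough to check the generating
  -- operators and the identity, which enters through the shift of `opH`.
  let S : Submodule ℂ (Module.End ℂ (GraphSpaceO g n)) :=
    LinearMap.ker (LinearMap.mulLeft ℂ (chordProj g n) - LinearMap.mulRight ℂ (chordProj g n))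
  have hS : ∀ T, T ∈ S ↔ chordProj g n * T = T * chordProj g n := fun T => by
    simp [S, sub_eq_zero]
  have : rho n X ∈ S := by
    refine rho_mem (fun i j => ?_) (fun i j => ?_) (fun i j => ?_) ?_ X <;> rw [hS]
    · refine commute_chordProj fun D => ?_
      rw [opL_graphClass]
      exact Submodule.subset_span ⟨D.addChord i j, rfl, rfl⟩
    · refine commute_chordProj fun D => ?_
      rw [opH_graphClass]
      refine Submodule.sum_mem _ fun u _ => ?_
      split_ifs
      · exact Submodule.subset_span ⟨D.relabel u j, rfl, rfl⟩
      · exact zero_mem _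
    · refine commute_chordProj fun D => ?_
      rw [opΛ_graphClass]
      refine Submodule.smul_mem _ _ (Submodule.sum_mem _ fun p _ => ?_)
      split_ifs
      · by_cases h : p.1 = p.2
        · rw [h, joinClass_self]
          exact zero_mem _
        · rw [joinClass_of_ne _ _ _ h]
          exact Submodule.subset_span ⟨D.join p.1 p.2 h, rfl, rfl⟩
      · exact zero_mem _
    · rw [mul_one, one_mul]
  exact LinearMap.congr_fun ((hS _).1 this) x

theorem chordProj_mem_degreeLowering : chordProj g n ∈ degreeLowering g n :=
  mem_degreeLowering_of_graphClass fun d D hD => by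
    by_cases h : IsEmpty D.V
    · rw [chordProj_of_isEmpty h]
      exact graphClass_mem_degreeFiltration D (by omega)
    · rw [chordProj_of_not_isEmpty h]
      exact zero_mem _

end projection

/-! ### The weight system counting edge colourings with three colours -/

section weight

/-- Twice the Levi-Civita symbol. -/
def levi (a b c : Fin 3) : ℤ := ((b : ℤ) - a) * ((c : ℤ) - a) * ((c : ℤ) - b)

theorem levi_rotate (f : Fin 3 → Fin 3) (r : Fin 3) :
    levi (f (0 + r)) (f (1 + r)) (f (2 + r)) = levi (f 0) (f 1) (f 2) := by
  fin_cases r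
  · rfl
  · change levi (f 1) (f 2) (f 0) = _
    unfold levi; ring
  · change levi (f 2) (f 0) (f 1) = _
    unfold levi; ring

theorem levi_swap (a b c : Fin 3) : levi a c b = -levi a b c := by
  unfold levi; ring

/-- As `t` varies, `e + t` runs over all colours, so this is the contraction of two Levi-Civita
tensors summed cyclically over `a`, `b`, `c`: the Jacobi identity for the cross product. The offset
`e` matches the shifted colourings in `weight_ihx`. -/
theorem levi_jacobi : ∀ e a b c d : Fin 3, ∑ t : Fin 3,
    (levi (e + t) a b * levi (e + t) c d + levi (e + t) c a * levi (e + t) b d +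
      levi (e + t) b c * levi (e + t) a d) = 0 := by
  decide

/-- The contribution of a colouring of half-edges at a trivalent vertex. -/
def leviAt {V U : Type} (c : HalfEdge V U → Fin 3) (v : V) : ℤ :=
  levi (c (Sum.inl (v, 0))) (c (Sum.inl (v, 1))) (c (Sum.inl (v, 2)))

namespace MarkedGraph

/-- Colourings of half-edges which are constant on edges. -/
def IsColouring (D : MarkedGraph g) (c : HalfEdge D.V D.U → Fin 3) : Prop :=
  ∀ x, c (D.glue x) = c x

open Classical in
/-- The signed count of colourings of the edges with three colours. -/
noncomputable def weight (D : MarkedGraph g) : ℤ :=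
  ∑ c : HalfEdge D.V D.U → Fin 3,
    if D.IsColouring c then ∏ v, leviAt c v else 0

theorem isoMap_bijective {D E : MarkedGraph g} (eV : D.V ≃ E.V) (eU : D.U ≃ E.U)
    (r : D.V → Fin 3) : Function.Bijective (isoMap eV eU r) := by
  rw [Fintype.bijective_iff_injective_and_card]
  exact ⟨isoMap_injective eV eU r,
    Fintype.card_congr (Equiv.sumCongr (eV.prodCongr (Equiv.refl _)) eU)⟩

theorem weight_iso {D E : MarkedGraph g} (h : D.Iso E) : D.weight = E.weight := by
  classical
  obtain ⟨eV, eU, r, hg, -, -⟩ := h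
  have hg' : ∀ x, isoMap eV eU r (D.glue x) = E.glue (isoMap eV eU r x) := hg
  let φ : HalfEdge D.V D.U ≃ HalfEdge E.V E.U :=
    Equiv.ofBijective _ (isoMap_bijective eV eU r)
  refine (Fintype.sum_equiv (φ.symm.arrowCongr (Equiv.refl (Fin 3))) _ _ fun c => ?_).symm
  have hc : ∀ x, (φ.symm.arrowCongr (Equiv.refl (Fin 3))) c x = c (isoMap eV eU r x) :=
    fun x => rfl
  refine if_congr ?_ ?_ rfl
  · simp only [IsColouring, hc, hg']
    constructor
    · exact fun h x => h _
    · intro h x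
      obtain ⟨y, rfl⟩ := (isoMap_bijective eV eU r).2 x
      exact h y
  · refine (Fintype.prod_equiv eV _ _ fun v => ?_).symm
    exact levi_rotate (fun k => c (Sum.inl (eV v, k))) (r v)

/-- Transporting colourings along `q` keeps the set of colourings of `D` and moves the permutation
into the vertex factors, so all terms of AS or IHX become sums over the same colourings. -/
theorem weight_reattach (D : MarkedGraph g) (q : Equiv.Perm (HalfEdge D.V D.U)) :
    open Classical in (D.reattach q).weight = ∑ c : HalfEdge D.V D.U → Fin 3,
      if D.IsColouring c then ∏ v, leviAt (fun x => c (q.symm x)) v else 0 := by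
  classical
  refine (Fintype.sum_equiv (q.arrowCongr (Equiv.refl (Fin 3))) _ _ fun c => ?_).symm
  refine if_congr ?_ rfl rfl
  rw [IsColouring]
  change (∀ x, c (D.glue x) = c x) ↔
    ∀ x, c (q.symm (q (D.glue (q.symm x)))) = c (q.symm x)
  simp only [Equiv.symm_apply_apply]
  constructor
  · exact fun h x => h _
  · intro h x
    simpa using h (q x)

theorem weight_flip (D : MarkedGraph g) (v : D.V) : D.weight + (D.flip v).weight = 0 := by
  classical
  rw [flip, weight_reattach, weight, ← Finset.sum_add_distrib]
  refine Finset.sum_eq_zero fun c _ => ?_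
  split_ifs with h
  · rw [← Finset.mul_prod_erase Finset.univ _ (Finset.mem_univ v),
      ← Finset.mul_prod_erase Finset.univ (leviAt _) (Finset.mem_univ v)]
    have h1 : leviAt (fun x => c ((Equiv.swap (Sum.inl (v, 1)) (Sum.inl (v, 2))).symm x)) v =
        -leviAt c v := by
      have := levi_swap (c (Sum.inl (v, 0))) (c (Sum.inl (v, 1))) (c (Sum.inl (v, 2)))
      simpa [leviAt, Equiv.swap_apply_def] using this
    have h2 : ∀ w ∈ Finset.univ.erase v,
        leviAt (fun x => c ((Equiv.swap (Sum.inl (v, 1)) (Sum.inl (v, 2))).symm x)) w =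
          leviAt c w := by
      intro w hw
      have hw := Finset.ne_of_mem_erase hw
      simp [leviAt, Equiv.swap_apply_def, hw]
    rw [h1, Finset.prod_congr rfl h2]
    ring
  · simp

/-- For fixed colours on all other edges, summing over the colour of the edge between `v` and `w`
leaves the Jacobi identity times the factors at the other vertices. -/
theorem weight_ihx (D : MarkedGraph g) (v w : D.V) (hvw : v ≠ w)
    (he : D.glue (Sum.inl (v, 0)) = Sum.inl (w, 0)) :
    D.weight + (D.reattach (D.ihxPerm v w)).weight +
      (D.reattach (D.ihxPerm v w)⁻¹).weight = 0 := by
  classical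
  have he' : D.glue (Sum.inl (w, 0)) = Sum.inl (v, 0) := by rw [← he, D.glue_glue]
  set q := D.ihxPerm v w with hq
  let G : (HalfEdge D.V D.U → Fin 3) → ℤ := fun c => (∏ u, leviAt c u) +
    (∏ u, leviAt (fun x => c (q.symm x)) u) + ∏ u, leviAt (fun x => c (q⁻¹.symm x)) u
  -- Adding `f t` shifts the colour of the edge between `v` and `w` by `t` and changes nothing else;
  -- `f t` is constant on edges, so this permutes the colourings.
  let f : Fin 3 → HalfEdge D.V D.U → Fin 3 := fun t x =>
    if x = Sum.inl (v, 0) ∨ x = Sum.inl (w, 0) then t else 0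
  have hf : ∀ t x, f t (D.glue x) = f t x := by
    intro t x
    simp only [f, glue_eq_iff, he, he']
    exact if_congr or_comm rfl rfl
  have hG : ∀ c : HalfEdge D.V D.U → Fin 3, D.IsColouring c →
      ∑ t, G (c + f t) = 0 := by
    intro c hc
    have hcvw : c (Sum.inl (w, 0)) = c (Sum.inl (v, 0)) := by rw [← he, hc]
    have hsplit : ∀ F : D.V → ℤ, ∏ u, F u = F v * F w *
        ∏ u ∈ (Finset.univ.erase v).erase w, F u := by
      intro F
      rw [← Finset.mul_prod_erase Finset.univ F (Finset.mem_univ v),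
        ← Finset.mul_prod_erase (Finset.univ.erase v) F (Finset.mem_erase.2 ⟨hvw.symm,
          Finset.mem_univ w⟩), mul_assoc]
    have hrest : ∀ (t : Fin 3) (p : Equiv.Perm (HalfEdge D.V D.U)),
        (∀ u k, u ≠ v → u ≠ w → p (Sum.inl (u, k)) = Sum.inl (u, k)) →
        ∏ u ∈ (Finset.univ.erase v).erase w, leviAt (fun x => (c + f t) (p x)) u =
          ∏ u ∈ (Finset.univ.erase v).erase w, leviAt c u := by
      intro t p hp
      refine Finset.prod_congr rfl fun u hu => ?_
      have h1 := Finset.ne_of_mem_erase hu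
      have h2 := Finset.ne_of_mem_erase (Finset.mem_of_mem_erase hu)
      simp [leviAt, hp u _ h2 h1, f, h1, h2]
    have q0 : ∀ u k, u ≠ v → u ≠ w → q (Sum.inl (u, k)) = Sum.inl (u, k) := by
      intro u k h1 h2
      simp [hq, ihxPerm, Equiv.swap_apply_def, h1, h2]
    have q1 : q (Sum.inl (v, 0)) = Sum.inl (v, 0) := by
      simp [hq, ihxPerm, Equiv.swap_apply_def]
    have q2 : q (Sum.inl (v, 1)) = Sum.inl (v, 2) := by
      simp [hq, ihxPerm, Equiv.swap_apply_def, hvw]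
    have q3 : q (Sum.inl (v, 2)) = Sum.inl (w, 1) := by
      simp [hq, ihxPerm, Equiv.swap_apply_def, hvw.symm]
    have q4 : q (Sum.inl (w, 0)) = Sum.inl (w, 0) := by
      simp [hq, ihxPerm, Equiv.swap_apply_def]
    have q5 : q (Sum.inl (w, 1)) = Sum.inl (v, 1) := by
      simp [hq, ihxPerm]
    have q6 : q (Sum.inl (w, 2)) = Sum.inl (w, 2) := by
      simp [hq, ihxPerm, Equiv.swap_apply_def, hvw.symm]
    have qs : ∀ {x y}, q x = y → q.symm y = x := fun h => (Equiv.symm_apply_eq q).2 h.symm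
    have hr := fun t => hrest t q q0
    have hr' := fun t => hrest t q.symm fun u k h1 h2 => qs (q0 u k h1 h2)
    have hr1 := fun t => hrest t 1 fun _ _ _ _ => rfl
    simp only [Equiv.Perm.one_apply] at hr1
    have hterm : ∀ t, G (c + f t) =
        (levi (c (Sum.inl (v, 0)) + t) (c (Sum.inl (v, 1))) (c (Sum.inl (v, 2))) *
          levi (c (Sum.inl (v, 0)) + t) (c (Sum.inl (w, 1))) (c (Sum.inl (w, 2))) +
        levi (c (Sum.inl (v, 0)) + t) (c (Sum.inl (w, 1))) (c (Sum.inl (v, 1))) *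
          levi (c (Sum.inl (v, 0)) + t) (c (Sum.inl (v, 2))) (c (Sum.inl (w, 2))) +
        levi (c (Sum.inl (v, 0)) + t) (c (Sum.inl (v, 2))) (c (Sum.inl (w, 1))) *
          levi (c (Sum.inl (v, 0)) + t) (c (Sum.inl (v, 1))) (c (Sum.inl (w, 2)))) *
        ∏ u ∈ (Finset.univ.erase v).erase w, leviAt c u := by
      intro t
      have hinv : q⁻¹.symm = q := rfl
      simp only [G, hsplit, hinv, hr, hr', hr1]
      simp only [leviAt, q1, q2, q3, q4, q5, q6, qs q1, qs q2, qs q3, qs q4, qs q5, qs q6,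
        Pi.add_apply, f, hcvw]
      simp
      ring
    simp only [hterm, ← Finset.sum_mul]
    rw [levi_jacobi, zero_mul]
  -- Averaging over the three shifts replaces splitting off the colour of the inner edge: the sum is
  -- unchanged by each shift, and three times it is a sum of vanishing inner sums.
  have h3 : 3 * ∑ c : HalfEdge D.V D.U → Fin 3,
      (if D.IsColouring c then G c else 0) = 0 := by
    have h4 : ∀ t, (∑ c : HalfEdge D.V D.U → Fin 3,
        (if D.IsColouring c then G c else 0)) = ∑ c : HalfEdge D.V D.U → Fin 3,
        (if D.IsColouring c then G (c + f t) else 0) := by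
      intro t
      refine (Fintype.sum_equiv (Equiv.addRight (f t)) _ _ fun c => ?_).symm
      refine if_congr ?_ rfl rfl
      simp [IsColouring, hf]
    have h5 : 3 * ∑ c : HalfEdge D.V D.U → Fin 3,
        (if D.IsColouring c then G c else 0) = ∑ t : Fin 3,
        ∑ c : HalfEdge D.V D.U → Fin 3, (if D.IsColouring c then G (c + f t) else 0) := by
      simp only [← h4]
      simp
    rw [h5, Finset.sum_comm]
    refine Finset.sum_eq_zero fun c _ => ?_
    split_ifs with h
    · exact hG c h
    · simp
  rw [weight_reattach, weight_reattach, weight, ← Finset.sum_add_distrib, ← Finset.sum_add_distrib]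
  refine Eq.trans (Finset.sum_congr rfl fun c _ => ?_) ((mul_eq_zero.1 h3).resolve_left (by norm_num))
  simp only [G]
  split_ifs <;> simp

end MarkedGraph

end weight

/-! ### Nonvanishing of the empty and theta graphs, and the invariant subspaces. -/

section reducibility

/-- AS, IHX and the circle relation preserve the numbers of trivalent and univalent vertices, so the
restriction to closed graphs with `k` vertices is compatible with them. Circles are weighted by
`-2n` directly instead of being coloured. -/
theorem weightFunctional_isGraphInvariant (g n k : ℕ) : open Classical in
    IsGraphInvariant n fun D : MarkedGraph g =>
      if Fintype.card D.V = k ∧ IsEmpty D.U then (-(2 * (n : ℂ))) ^ D.circles * (D.weight : ℂ)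
      else 0 := by
  classical
  refine ⟨fun {D E} h => ?_, fun D v => ?_, fun D v w hvw he => ?_, fun D => ?_⟩
  · have hw := weight_iso h
    obtain ⟨eV, eU, r, -, -, hc⟩ := h
    simp only [hw, hc, Fintype.card_congr eV, eU.isEmpty_congr]
  · have h := congrArg (Int.cast : ℤ → ℂ) (D.weight_flip v)
    push_cast at h
    change ite (Fintype.card D.V = k ∧ IsEmpty D.U) (_ ^ D.circles * _) 0 +
      ite (Fintype.card D.V = k ∧ IsEmpty D.U) (_ ^ D.circles * _) 0 = 0
    split_ifs
    · rw [← mul_add, h, mul_zero]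
    · simp
  · have h := congrArg (Int.cast : ℤ → ℂ) (D.weight_ihx v w hvw he)
    push_cast at h
    change ite (Fintype.card D.V = k ∧ IsEmpty D.U) (_ ^ D.circles * _) 0 +
      ite (Fintype.card D.V = k ∧ IsEmpty D.U) (_ ^ D.circles * _) 0 +
      ite (Fintype.card D.V = k ∧ IsEmpty D.U) (_ ^ D.circles * _) 0 = 0
    split_ifs
    · rw [← mul_add, ← mul_add, h, mul_zero]
    · simp
  · change ite (Fintype.card D.V = k ∧ IsEmpty D.U) (_ ^ (D.circles + 1) * (D.weight : ℂ)) 0 +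
      (2 * (n : ℂ)) • ite (Fintype.card D.V = k ∧ IsEmpty D.U) (_ ^ D.circles * (D.weight : ℂ)) 0 = 0
    split_ifs
    · rw [smul_eq_mul]
      ring
    · simp

/-- The functional which counts coloured closed graphs with `k` vertices. -/
noncomputable def weightFunctional (g n k : ℕ) : GraphSpaceO g n →ₗ[ℂ] ℂ :=
  (weightFunctional_isGraphInvariant g n k).lift

theorem weightFunctional_eq_zero {n k d : ℕ} (hd : k < 2 * d) {x : GraphSpaceO g n}
    (hx : x ∈ degreeFiltration g n d) : weightFunctional g n k x = 0 := by
  classical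
  refine LinearMap.eqOn_span (f := weightFunctional g n k) (g := 0) ?_ hx
  rintro _ ⟨D, hD, rfl⟩
  refine ((weightFunctional_isGraphInvariant g n k).lift_graphClass D).trans (if_neg ?_)
  rintro ⟨h1, h2⟩
  have : Fintype.card D.U = 0 := Fintype.card_eq_zero
  unfold degree at hD
  omega

/-- The theta graph. -/
def thetaGraph (g : ℕ) : MarkedGraph g where
  V := Fin 2
  U := Empty
  glue := Sum.map (fun p => (1 - p.1, p.2)) id
  glue_glue := by rintro (⟨v, k⟩ | u) <;> simp
  glue_ne := by
    rintro (⟨v, k⟩ | u)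
    · fin_cases v <;> simp
    · exact u.elim
  label := Empty.elim
  circles := 0

/-- The empty graph. -/
def emptyGraph (g : ℕ) : MarkedGraph g where
  V := Empty
  U := Empty
  glue := id
  glue_glue := fun _ => rfl
  glue_ne := by rintro (⟨v, k⟩ | u) <;> contradiction
  label := Empty.elim
  circles := 0

theorem weight_emptyGraph : (emptyGraph g).weight = 1 := by
  classical
  have : IsEmpty (HalfEdge (emptyGraph g).V (emptyGraph g).U) :=
    inferInstanceAs (IsEmpty ((Empty × Fin 3) ⊕ Empty))
  have h : IsEmpty (emptyGraph g).V := inferInstanceAs (IsEmpty Empty)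
  refine (Fintype.sum_unique _).trans ((if_pos fun x => isEmptyElim x).trans ?_)
  rw [Finset.univ_eq_empty, Finset.prod_empty]

/-- Both vertices see the same three colours in the same cyclic order, so each colouring contributes
a square; the colouring with three distinct colours contributes a positive one. -/
theorem weight_thetaGraph_pos : 0 < (thetaGraph g).weight := by
  classical
  have key : ∀ c : HalfEdge (Fin 2) Empty → Fin 3, (thetaGraph g).IsColouring c →
      ∏ v : Fin 2, leviAt c v = leviAt c (0 : Fin 2) ^ 2 := by
    intro c hc
    have h : ∀ k : Fin 3, c (Sum.inl (1, k)) = c (Sum.inl (0, k)) := fun k => hc (Sum.inl ((0 : Fin 2), k))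
    rw [Fin.prod_univ_two, sq]
    congr 1
    simp only [leviAt, h]
  have hnn : ∀ c : HalfEdge (Fin 2) Empty → Fin 3, 0 ≤
      if (thetaGraph g).IsColouring c then ∏ v : Fin 2, leviAt c v else 0 := by
    intro c
    split_ifs with hc
    · rw [key c hc]
      positivity
    · exact le_rfl
  let c₀ : HalfEdge (Fin 2) Empty → Fin 3 := Sum.elim Prod.snd Empty.elim
  have hc₀ : (thetaGraph g).IsColouring c₀ := by
    rintro (⟨v, k⟩ | u)
    · rfl
    · exact u.elim
  refine Finset.sum_pos' (fun c _ => hnn c) ⟨c₀, Finset.mem_univ _, ?_⟩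
  refine lt_of_lt_of_eq ?_ (if_pos hc₀).symm
  refine lt_of_lt_of_eq ?_ (key c₀ hc₀).symm
  decide

theorem weightFunctional_emptyGraph (n : ℕ) :
    weightFunctional g n 0 (graphClass n (emptyGraph g)) ≠ 0 := by
  classical
  rw [weightFunctional, IsGraphInvariant.lift_graphClass, weight_emptyGraph, if_pos]
  · exact (by simp : (-(2 * (n : ℂ))) ^ 0 * ((1 : ℤ) : ℂ) ≠ 0)
  · exact ⟨rfl, inferInstanceAs (IsEmpty Empty)⟩

theorem weightFunctional_thetaGraph (n : ℕ) :
    weightFunctional g n 2 (graphClass n (thetaGraph g)) ≠ 0 := by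
  classical
  rw [weightFunctional, IsGraphInvariant.lift_graphClass, if_pos]
  · have h : (((thetaGraph g).weight : ℤ) : ℂ) ≠ 0 :=
      Int.cast_ne_zero.2 weight_thetaGraph_pos.ne'
    exact (by simpa using h :
      (-(2 * (n : ℂ))) ^ 0 * (((thetaGraph g).weight : ℤ) : ℂ) ≠ 0)
  · exact ⟨rfl, inferInstanceAs (IsEmpty Empty)⟩

variable {n : ℕ}

theorem chordProj_thetaGraph : chordProj g n (graphClass n (thetaGraph g)) = 0 :=
  chordProj_of_not_isEmpty fun h => h.elim (0 : Fin 2)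

theorem chordProj_emptyGraph :
    chordProj g n (graphClass n (emptyGraph g)) = graphClass n (emptyGraph g) :=
  chordProj_of_isEmpty (inferInstanceAs (IsEmpty Empty))

theorem toCompleted_ne_zero {k : ℕ} {x : GraphSpaceO g n} (hx : weightFunctional g n k x ≠ 0) :
    toCompleted g n x ≠ 0 := by
  intro h
  -- Level `k + 1` is deep enough, since the functional with `k` vertices vanishes in degrees above
  -- `k / 2`.
  have h1 : (toCompleted g n x).1 (k + 1) = 0 := by rw [h]; rfl
  exact hx (weightFunctional_eq_zero (d := k + 1) (by omega)
    ((Submodule.Quotient.mk_eq_zero _).1 h1))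

theorem exists_invariant_subspace :
    ∃ S : Submodule ℂ (GraphSpaceO g n), S ≠ ⊥ ∧ S ≠ ⊤ ∧ ∀ X, ∀ s ∈ S, rho n X s ∈ S := by
  refine ⟨LinearMap.ker (chordProj g n), fun h => ?_, fun h => ?_, fun X s hs => ?_⟩
  · have h1 : graphClass n (thetaGraph g) ∈ LinearMap.ker (chordProj g n) := chordProj_thetaGraph
    rw [h, Submodule.mem_bot] at h1
    exact weightFunctional_thetaGraph n (by rw [h1, map_zero])
  · have h1 : graphClass n (emptyGraph g) ∈ LinearMap.ker (chordProj g n) := h ▸ Submodule.mem_top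
    rw [LinearMap.mem_ker, chordProj_emptyGraph] at h1
    exact weightFunctional_emptyGraph n (by rw [h1, map_zero])
  · rw [LinearMap.mem_ker] at hs ⊢
    rw [chordProj_comm_rho, hs, map_zero]

theorem exists_closed_invariant_subspace :
    ∃ S : Submodule ℂ (completedGraphSpaceO g n), S ≠ ⊥ ∧ S ≠ ⊤ ∧
      IsClosedSubspace S ∧ ∀ X, ∀ s ∈ S, rhoCompleted n X s ∈ S := by
  let P := extendCompleted (chordProj g n) chordProj_mem_degreeLowering
  refine ⟨LinearMap.ker P, fun h => ?_, fun h => ?_, fun y hy => ?_, fun X s hs => ?_⟩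
  · have h1 : toCompleted g n (graphClass n (thetaGraph g)) ∈ LinearMap.ker P := by
      rw [LinearMap.mem_ker, extendCompleted_toCompleted, chordProj_thetaGraph, map_zero]
    rw [h, Submodule.mem_bot] at h1
    exact toCompleted_ne_zero (weightFunctional_thetaGraph n) h1
  · have h1 : toCompleted g n (graphClass n (emptyGraph g)) ∈ LinearMap.ker P :=
      h ▸ Submodule.mem_top
    rw [LinearMap.mem_ker, extendCompleted_toCompleted, chordProj_emptyGraph] at h1
    exact toCompleted_ne_zero (weightFunctional_emptyGraph n) h1
  · refine LinearMap.mem_ker.2 (Subtype.ext (funext fun d => ?_))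
    -- Component `d` of `P y` depends only on component `d + 1` of `y`, where `y` agrees with an
    -- element of the kernel.
    obtain ⟨s, hs, hsy⟩ := hy (d + 1)
    obtain ⟨x, hx⟩ := completed_exists_mkQ y (d + 1)
    have h1 : (P s).1 d = 0 := by rw [LinearMap.mem_ker.1 hs]; rfl
    rw [extendCompleted_apply _ y hx, ← extendCompleted_apply _ s (hsy.trans hx)]
    exact h1
  · have hX := rho_mem_degreeLowering (n := n) X
    refine LinearMap.mem_ker.2 (Subtype.ext (funext fun d => ?_))
    obtain ⟨x, hx⟩ := completed_exists_mkQ s (d + 1 + 1)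
    have h2 : (P (extendCompleted (rho n X) hX s)).1 d =
        (extendCompleted (rho n X) hX (P s)).1 d := by
      rw [extendCompleted_extendCompleted _ _ s hx, extendCompleted_extendCompleted _ _ s hx,
        chordProj_comm_rho]
    rw [LinearMap.mem_ker.1 hs, map_zero] at h2
    exact h2

end reducibility

open Classical in
theorem mainTheorem8 (g n : ℕ) :
    ∃ L h Λ : Fin g → Fin g → Module.End ℂ (GraphSpaceO g n),
      -- the action of the operators on graphs
      (∀ (i j : Fin g) (D : MarkedGraph g),
        L i j (graphClass n D) = graphClass n (D.addChord i j)) ∧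
      (∀ (i j : Fin g) (D : MarkedGraph g),
        h i j (graphClass n D) =
          ∑ u : D.U, if D.label u = i then graphClass n (D.relabel u j) else 0) ∧
      (∀ (i j : Fin g) (D : MarkedGraph g),
        Λ i j (graphClass n D) =
          (-1 / 4 : ℂ) • ∑ a : D.U, ∑ b : D.U,
            if hab : a ≠ b ∧ D.label a = i ∧ D.label b = j then
              graphClass n (D.join a b hab.1) else 0) ∧
      -- the commutation relations
      (∀ i j k l : Fin g,
        ⁅Λ i j, L k l⁆ =
          ((n : ℂ) / 2 * (kron i l * kron j k + kron i k * kron j l)) • 1 -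
            (1 / 4 : ℂ) • (kron i k • h j l + kron i l • h j k +
              kron j k • h i l + kron j l • h i k)) ∧
      (∀ i j k l : Fin g,
        ⁅h k l, L i j⁆ = kron k i • L l j + kron k j • L i l) ∧
      (∀ i j k l : Fin g,
        ⁅h k l, Λ i j⁆ = -(kron i l • Λ k j) - kron j l • Λ i k) ∧
      (∀ i j k l : Fin g,
        ⁅h i j, h k l⁆ = kron i l • h k j - kron k j • h i l) ∧
      (∀ i j k l : Fin g, ⁅Λ i j, Λ k l⁆ = 0) ∧
      (∀ i j k l : Fin g, ⁅L i j, L k l⁆ = 0) ∧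
      -- the representation of the Lie algebra
      ∃ ρ : LieAlgebra.Symplectic.sp (Fin g) ℂ →ₗ⁅ℂ⁆ Module.End ℂ (GraphSpaceO g n),
        (∀ i j, ρ (spL i j) = L i j) ∧
        (∀ i j, ρ (spΛ i j) = Λ i j) ∧
        (∀ i j, ρ (spH i j) = h i j - ((n : ℂ) * kron i j) • 1) ∧
        -- it is reducible
        (∃ S : Submodule ℂ (GraphSpaceO g n), S ≠ ⊥ ∧ S ≠ ⊤ ∧ ∀ X, ∀ s ∈ S, ρ X s ∈ S) ∧
        -- it extends continuously to the completion, and is reducible there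
        ∃ ρc : LieAlgebra.Symplectic.sp (Fin g) ℂ →ₗ⁅ℂ⁆ Module.End ℂ (completedGraphSpaceO g n),
          (∀ X x, ρc X (toCompleted g n x) = toCompleted g n (ρ X x)) ∧
          (∀ X (d : ℕ), ∃ e : ℕ, ∀ y : completedGraphSpaceO g n,
            y.1 e = 0 → (ρc X y).1 d = 0) ∧
          (∃ S : Submodule ℂ (completedGraphSpaceO g n), S ≠ ⊥ ∧ S ≠ ⊤ ∧
            IsClosedSubspace S ∧ ∀ X, ∀ s ∈ S, ρc X s ∈ S) := by
  refine ⟨opL n, opH n, opΛ n, opL_graphClass, opH_graphClass, fun i j D => ?_, lie_opΛ_opL,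
    lie_opH_opL, lie_opH_opΛ, lie_opH_opH, lie_opΛ_opΛ, lie_opL_opL, rho n, rho_spL n, rho_spΛ n,
    rho_spH n, exists_invariant_subspace, rhoCompleted n, fun X x => ?_, fun X d => ?_,
    exists_closed_invariant_subspace⟩
  · rw [opΛ_graphClass, joinSum_eq]
  · exact extendCompleted_toCompleted (rho_mem_degreeLowering X) x
  · exact ⟨d + 1, fun y hy => extendCompleted_apply_eq_zero (rho_mem_degreeLowering X) y hy⟩
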